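/- **Theorem.** All graphs are finite and simple. A graph is *2-connected* if it has at least two vertices and cannot be disconnected by deleting fewer than two vertices (so the graph consisting of a single edge and its two end vertices is 2-connected, and the one-vertex graph is not); a *block* of a graph is a maximal 2-connected induced subgraph. A *labelled graph class* $\mathcal{G}=\bigcup_{n\ge 0}\mathcal{G}_n$ consists of sets $\mathcal{G}_n$ of graphs on the vertex set $\{1,\dots,n\}$ and is closed under isomorphism; its exponential generating function is $\mathcal{G}(z)=\sum_{n\ge 0}|\mathcal{G}_n|\,z^n/n!$. The class is *block-stable* if it contains the graph consisting of a single edge and its two end vertices, and a graph belongs to $\mathcal{G}$ if and only if all its blocks belong to $\mathcal{G}$. Let $\mathcal{G}$ be a block-stable labelled graph class, let $\mathcal{C}$ and $\mathcal{B}$ be its subclasses of connected and of 2-connected graphs, with exponential generating functions $\mathcal{C}(z)$ and $\mathcal{B}(y)$, and put $\mathcal{C}^{\bullet}(z)=z\,\mathcal{C}'(z)$. Let $\rho$ and $\eta$ (in $[0,\infty]$) be the radii of convergence of $\mathcal{C}^{\bullet}(z)$ and of $\mathcal{B}'(y)$. Assume that $\mathcal{G}$ is *subcritical*, that is, $\mathcal{C}^{\bullet}(\rho)<\eta$,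 and that there is $n_0$ with $[z^n]\,\mathcal{C}^{\bullet}(z)>0$ for all $n\ge n_0$. Then, with $\gamma=1/\rho$, one has $e\le\gamma<\infty$, and there is a constant $c>0$ such that $$\frac{|\mathcal{G}_n|}{n!}=[z^n]\,\mathcal{G}(z)=c\,n^{-5/2}\,\gamma^n\,(1+o(1))\qquad (n\to\infty).$$ -/

import Mathlib

open scoped ENNReal PowerSeries

namespace SimpleGraph

/-- A graph is `2`-connected if it has at least two vertices and cannot be disconnected by
deleting fewer than two vertices: it is connected, and it stays connected when any single vertex
is deleted. The graph with one edge and its two end vertices is `2`-connected; the graph with a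
single vertex is not. -/
def IsTwoConnected {V : Type*} (G : SimpleGraph V) : Prop :=
  Nontrivial V ∧ G.Connected ∧ ∀ v : V, (G.induce {v}ᶜ).Connected

/-- `S` is the vertex set of a block of `G`: the induced subgraph on `S` is a maximal
`2`-connected induced subgraph. -/
def IsBlock {V : Type*} (G : SimpleGraph V) (S : Set V) : Prop :=
  Maximal (fun T : Set V => (G.induce T).IsTwoConnected) S

theorem IsTwoConnected.of_iso {V W : Type*} {G : SimpleGraph V} {H : SimpleGraph W}
    (e : G ≃g H) (h : G.IsTwoConnected) : H.IsTwoConnected := by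
  obtain ⟨h1, h2, h3⟩ := h
  refine ⟨e.toEquiv.symm.nontrivial, e.connected_iff.mp h2, fun w => ?_⟩
  have hb : Set.BijOn e ({e.symm w}ᶜ : Set V) ({w}ᶜ : Set W) := by
    refine ⟨fun x hx hxw => hx ?_, e.injective.injOn, fun y hy => ⟨e.symm y, ?_, by simp⟩⟩
    · have hxw' : e x = w := hxw
      simp [← hxw']
    · intro hyw
      exact hy (e.symm.injective hyw)
  exact (e.induce hb).connected_iff.mp (h3 _)

end SimpleGraph

/-- A class of labelled (simple, finite) graphs: for every `n`, a set of graphs on the label set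
`Fin n`, stable under isomorphism, in particular under relabelling. -/
structure LabelledGraphClass where
  /-- The members of the class with `n` vertices. -/
  graphs : (n : ℕ) → Set (SimpleGraph (Fin n))
  /-- Stability under isomorphism. -/
  iso_mem : ∀ {n : ℕ} {G H : SimpleGraph (Fin n)}, Nonempty (G ≃g H) → G ∈ graphs n → H ∈ graphs n

namespace LabelledGraphClass

/-- A finite graph on an arbitrary vertex type belongs to the class if some labelling of it does
(equivalently, if all its labellings do). -/
def Contains (𝒢 : LabelledGraphClass) {V : Type*} (G : SimpleGraph V) : Prop :=
  ∃ (n : ℕ) (H : SimpleGraph (Fin n)), H ∈ 𝒢.graphs n ∧ Nonempty (G ≃g H)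

/-- The subclass `𝒞` of connected graphs of the class. -/
def connectedSubclass (𝒢 : LabelledGraphClass) : LabelledGraphClass where
  graphs n := {G | G ∈ 𝒢.graphs n ∧ G.Connected}
  iso_mem := fun e h => ⟨𝒢.iso_mem e h.1, e.some.connected_iff.mp h.2⟩

/-- The subclass `ℬ` of `2`-connected graphs of the class. -/
def twoConnectedSubclass (𝒢 : LabelledGraphClass) : LabelledGraphClass where
  graphs n := {G | G ∈ 𝒢.graphs n ∧ G.IsTwoConnected}
  iso_mem := fun e h => ⟨𝒢.iso_mem e h.1, h.2.of_iso e.some⟩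

/-- A class is block-stable if it contains the graph with one edge and its two end vertices, and
a graph belongs to the class if and only if all its blocks belong to the class. -/
def BlockStable (𝒢 : LabelledGraphClass) : Prop :=
  (⊤ : SimpleGraph (Fin 2)) ∈ 𝒢.graphs 2 ∧
  ∀ (n : ℕ) (G : SimpleGraph (Fin n)),
    G ∈ 𝒢.graphs n ↔ ∀ S : Set (Fin n), G.IsBlock S → 𝒢.Contains (G.induce S)

/-- The exponential generating function `𝒢(z) = ∑ |𝒢ₙ| zⁿ / n!`. -/
noncomputable def egf (𝒢 : LabelledGraphClass) : ℝ⟦X⟧ :=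
  PowerSeries.mk fun n => ((𝒢.graphs n).ncard : ℝ) / (n.factorial : ℝ)

/-- The exponential generating function `𝒢'(z)` of the derived class (one vertex is distinguished
and not labelled): the derivative of `𝒢(z)`. -/
noncomputable def derivedEgf (𝒢 : LabelledGraphClass) : ℝ⟦X⟧ :=
  PowerSeries.derivative ℝ 𝒢.egf

/-- The exponential generating function `𝒢•(z) = z 𝒢'(z)` of the rooted class (one labelled vertex
is distinguished). -/
noncomputable def rootedEgf (𝒢 : LabelledGraphClass) : ℝ⟦X⟧ :=
  PowerSeries.X * 𝒢.derivedEgf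

end LabelledGraphClass

/-- The radius of convergence, in `[0, ∞]`, of a real power series. -/
noncomputable def seriesRadius (f : ℝ⟦X⟧) : ℝ≥0∞ :=
  (FormalMultilinearSeries.ofScalars ℝ fun n => PowerSeries.coeff n f).radius

/-- The value, in `[0, ∞]`, of a power series with nonnegative coefficients at a point of
`[0, ∞]`. -/
noncomputable def seriesValue (f : ℝ⟦X⟧) (x : ℝ≥0∞) : ℝ≥0∞ :=
  ∑' n : ℕ, ENNReal.ofReal (PowerSeries.coeff n f) * x ^ n

/-- The pair `(f, g)` is subcritical: `f(ρ) < η`, where `ρ` and `η` are the radii of convergence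
of `f` and of `g`. -/
def SubcriticalPair (f g : ℝ⟦X⟧) : Prop :=
  seriesValue f (seriesRadius f) < seriesRadius g

/-- A labelled block-stable class is subcritical if the pair `(𝒞•(z), ℬ'(y))` is. -/
def LabelledGraphClass.Subcritical (𝒢 : LabelledGraphClass) : Prop :=
  SubcriticalPair 𝒢.connectedSubclass.rootedEgf 𝒢.twoConnectedSubclass.derivedEgf

/-! Write $y=\mathcal C^\bullet$ and $b=\mathcal B'$. The combinatorial input is the pair of
relations $y=z\,e^{b(y)}$ and $\mathcal G=e^{\mathcal C}$. Both are obtained from linear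
differential equations, $\mathcal G'=\mathcal C'\mathcal G$ and $\mathcal C''=(b(y))'\,\mathcal C'$,
so that one only has to split a graph into two pieces: the component of a root against the rest,
and, in a connected graph, the part beyond the root that contains a second marked vertex against the
rest. In the second split the root is not a cut vertex of the split part, hence lies in a single
block of it. The other vertices hang from this block, which is encoded by a unique retraction onto
the block; counting these retractions gives $b(y)$. Block-stability lets class membership be checked
piece by piece, since a 2-connected set never straddles two pieces.

The analytic part uses no analytic continuation. Subcriticality forces a point $\tau$ strictly
inside the disc of $b$ with $\tau b'(\tau)=1$ (`exists_critical_point`). Lagrange inversion gives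
$n[z^n]y=[u^{n-1}]e^{nb(u)}$, and Laplace's method on the circle $|u|=\tau$ shows that this
coefficient has order $n^{-1/2}\gamma^n$ with $\gamma=e^{b(\tau)}/\tau$; the linear phase cancels
because $\tau$ is critical, and $b_1>0$ (the single edge) makes $\theta=0$ the only maximum. Hence
$[z^n]y\sim c'n^{-3/2}\gamma^n$, which also identifies $\gamma$ with $1/\rho$. The bound $\gamma\ge
e$ follows from $b(\tau)\ge\tau$ and $e^\tau\ge e\tau$.

Finally $z\mathcal G'=y\,\mathcal G$ reads $n g_n=\sum_k y_k g_{n-k}$. As $y$ and $\mathcal G$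
converge at $\rho$, the terms with small $n-k$ dominate, and $g_n\sim c'\,\mathcal
G(\rho)\,n^{-5/2}\gamma^n$ (`tendsto_of_exp_recurrence`). -/

namespace PowerSeries

/-! ### Lagrange inversion and a first-order differential equation for formal power series. -/

variable {K : Type*} [Field K] [CharZero K]

/-- With $P=X/\varphi$ this coefficient is the residue of $P^{-m-1}P'$, which is an exact derivative
unless $m=0$. The proof stays within power series: after removing $X^k$, the two terms of
$\varphi^{m+1}-X\varphi^m\varphi'$ have the same coefficient of degree $m$ because
$(\varphi^{m+1})'=(m+1)\varphi^m\varphi'$. -/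
theorem coeff_X_mul_inv_pow_mul_derivative (φ : K⟦X⟧) (hφ : constantCoeff φ ≠ 0) (k m : ℕ) :
    coeff (k + m) ((X * φ⁻¹) ^ k * derivative K (X * φ⁻¹) * φ ^ (k + m + 1)) =
      if m = 0 then 1 else 0 := by
  set P : K⟦X⟧ := X * φ⁻¹ with hP
  have hPφ : P * φ = X := by rw [hP, mul_assoc, PowerSeries.inv_mul_cancel _ hφ, mul_one]
  have hd : derivative K P * φ = 1 - P * derivative K φ := by
    have h := congrArg (derivative K) hPφ
    rw [Derivation.leibniz, derivative_X, smul_eq_mul, smul_eq_mul] at h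
    linear_combination h
  have h1 : P ^ k * derivative K P * φ ^ (k + m + 1) =
      X ^ k * (φ ^ m * (1 - P * derivative K φ)) := by
    rw [← hd, ← hPφ]; ring
  rw [h1, add_comm k m, coeff_X_pow_mul]
  rcases m with _ | m
  · simp [hP]
  · have h2 : φ ^ (m + 1) * (1 - P * derivative K φ) =
        φ ^ (m + 1) - X * (φ ^ m * derivative K φ) := by
      rw [← hPφ]; ring
    have h3 : ((m : K) + 1) * coeff m (φ ^ m * derivative K φ) =
        coeff (m + 1) (φ ^ (m + 1)) * (m + 1) := by
      have h := coeff_derivative (R := K) (φ ^ (m + 1)) m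
      rw [← h, derivative_pow, Nat.add_sub_cancel, mul_assoc, ← map_natCast (C (R := K)), coeff_C_mul]
      push_cast; ring
    have hm : ((m : K) + 1) ≠ 0 := by exact_mod_cast Nat.succ_ne_zero m
    rw [h2, map_sub, coeff_succ_X_mul, if_neg (Nat.succ_ne_zero m), sub_eq_zero]
    apply mul_left_cancel₀ hm
    rw [h3]; ring

/-- Lagrange inversion: if `y = z φ(y)`, then `(n + 1) [zⁿ⁺¹] y = [uⁿ] φ(u)ⁿ⁺¹`. -/
theorem lagrange_inversion {y φ : K⟦X⟧} (hφ : constantCoeff φ ≠ 0)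
    (hy0 : constantCoeff y = 0) (hy : y = X * φ.subst y) (n : ℕ) :
    ((n : K) + 1) * coeff (n + 1) y = coeff n (φ ^ (n + 1)) := by
  have hys : HasSubst y := HasSubst.of_constantCoeff_zero' hy0
  set P : K⟦X⟧ := X * φ⁻¹ with hP
  have hP0 : constantCoeff P = 0 := by simp [hP]
  have hP1 : IsUnit (coeff 1 P) := by
    rw [hP, ← zero_add 1, coeff_succ_X_mul]
    simpa using hφ
  have hPs : HasSubst P := HasSubst.of_constantCoeff_zero' hP0
  have hPy : P.subst y = X := by
    have h1 : (φ⁻¹).subst y * φ.subst y = (1 : K⟦X⟧) := by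
      rw [← subst_mul hys, PowerSeries.inv_mul_cancel _ hφ]
      rw [← coe_substAlgHom hys, map_one]
    rw [hP, subst_mul hys, subst_X hys]
    calc y * (φ⁻¹).subst y = X * ((φ⁻¹).subst y * φ.subst y) := by
          nth_rewrite 1 [hy]; ring
      _ = X := by rw [h1, mul_one]
  -- A left compositional inverse of $P$ exists, and it must be $y$ because $P\circ y=X$.
  have hyP : y.subst P = X := by
    set Q := P.substInvOfIsUnit hP1
    have hQ : Q = y := by
      have h := subst_comp_subst_apply (R := K) hPs hys Q
      rw [subst_substInvOfIsUnit_left P hP0 hP1, subst_X hys, hPy] at h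
      rw [h, X_subst]
    rw [← hQ]; exact subst_substInvOfIsUnit_left P hP0 hP1
  have hder : (derivative K y).subst P * derivative K P = 1 := by
    rw [← derivative_subst hPs, hyP, derivative_X]
  -- The tail of $y'$ from degree $n+1$ on: after substituting $P$ it is divisible by $X^{n+1}$ and
  -- cannot affect the coefficient of degree $n$. This turns the expansion of $y'(P)$ into a finite
  -- sum, of which only the index $k=n$ survives.
  set S : K⟦X⟧ := mk fun i => coeff (i + (n + 1)) (derivative K y)
  have hsplit : (derivative K y).subst P =
      P ^ (n + 1) * S.subst P +
        ∑ k ∈ Finset.range (n + 1), C (coeff k (derivative K y)) * P ^ k := by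
    conv_lhs => rw [eq_X_pow_mul_shift_add_trunc (n + 1) (derivative K y)]
    rw [subst_add hPs, subst_mul hPs, subst_pow hPs, subst_X hPs, subst_coe hPs,
      Polynomial.aeval_eq_sum_range' (n := n + 1)]
    · congr 1
      refine Finset.sum_congr rfl fun k hk => ?_
      rw [coeff_trunc, if_pos (Finset.mem_range.mp hk), smul_eq_C_mul]
    · exact natDegree_trunc_lt _ _
  have hmain : φ ^ (n + 1) = P ^ (n + 1) * (S.subst P * derivative K P * φ ^ (n + 1)) +
      ∑ k ∈ Finset.range (n + 1),
        C (coeff k (derivative K y)) * (P ^ k * derivative K P * φ ^ (n + 1)) := by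
    calc φ ^ (n + 1) = (derivative K y).subst P * derivative K P * φ ^ (n + 1) := by
          rw [hder, one_mul]
      _ = _ := by
          rw [hsplit, add_mul, add_mul, Finset.sum_mul, Finset.sum_mul]
          congr 1
          · ring
          · exact Finset.sum_congr rfl fun k _ => by ring
  rw [hmain, map_add, map_sum, hP, mul_pow, mul_assoc, coeff_X_pow_mul', if_neg (by omega), zero_add]
  rw [Finset.sum_eq_single n]
  · rw [coeff_C_mul]
    have := coeff_X_mul_inv_pow_mul_derivative φ hφ n 0
    rw [add_zero, if_pos rfl] at this
    rw [this, coeff_derivative]; ring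
  · intro k hk hkn
    obtain ⟨m, rfl⟩ := Nat.exists_eq_add_of_le (Nat.lt_succ_iff.mp (Finset.mem_range.mp hk))
    rw [coeff_C_mul, coeff_X_mul_inv_pow_mul_derivative φ hφ k m, if_neg (by omega), mul_zero]
  · intro h; simp at h

/-- The solution of `F' = A' F` with `F(0) = 1` and `A(0) = 0` is `exp(A)`. -/
theorem eq_exp_subst_of_derivative [Algebra ℚ K] {F A : K⟦X⟧} (hA : constantCoeff A = 0)
    (hF : constantCoeff F = 1) (h : derivative K F = derivative K A * F) :
    F = (exp K).subst A := by
  have hAs : HasSubst A := HasSubst.of_constantCoeff_zero' hA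
  set E : K⟦X⟧ := (exp K).subst A with hE
  have hE' : derivative K E = E * derivative K A := by
    rw [hE, derivative_subst hAs, derivative_exp]
  have hE0 : constantCoeff E = 1 := by
    have h1 : E = 1 + (exp K - 1).subst A := by
      rw [subst_sub hAs, ← coe_substAlgHom hAs, map_one, hE, ← coe_substAlgHom hAs]; ring
    rw [h1, map_add, map_one]
    have := constantCoeff_subst_eq_zero (a := A) hA (exp K - 1) (by simp)
    rw [PowerSeries.constantCoeff, this, add_zero]
  have hEne : constantCoeff E ≠ 0 := by rw [hE0]; exact one_ne_zero
  -- The quotient has zero derivative and constant term 1.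
  have hq : F * E⁻¹ = 1 := by
    apply derivative.ext
    · rw [Derivation.leibniz, derivative_inv', h, hE', derivative_one, smul_eq_mul, smul_eq_mul]
      have := PowerSeries.mul_inv_cancel _ hEne
      linear_combination (-(F * derivative K A * E⁻¹)) * this
    · simp [hF, hE0]
  calc F = F * E⁻¹ * E := by rw [mul_assoc, PowerSeries.inv_mul_cancel _ hEne, mul_one]
    _ = E := by rw [hq, one_mul]

end PowerSeries

/-! ### Series with nonnegative coefficients and their values in $[0,\infty]$. -/

namespace PowerSeries

/-- All coefficients are nonnegative. -/
def Nonneg (f : ℝ⟦X⟧) : Prop := ∀ n, 0 ≤ coeff n f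

theorem Nonneg.mul {f g : ℝ⟦X⟧} (hf : f.Nonneg) (hg : g.Nonneg) : (f * g).Nonneg := fun n => by
  rw [coeff_mul]
  exact Finset.sum_nonneg fun p _ => mul_nonneg (hf _) (hg _)

theorem nonneg_one : Nonneg (1 : ℝ⟦X⟧) := fun n => by
  rw [coeff_one]; split_ifs <;> norm_num

theorem nonneg_X : Nonneg (X : ℝ⟦X⟧) := fun n => by
  rw [coeff_X]; split_ifs <;> norm_num

theorem Nonneg.pow {f : ℝ⟦X⟧} (hf : f.Nonneg) (k : ℕ) : (f ^ k).Nonneg := by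
  induction k with
  | zero => rw [pow_zero]; exact nonneg_one
  | succ k ih => rw [pow_succ]; exact ih.mul hf

theorem nonneg_exp : Nonneg (exp ℝ) := fun n => by
  rw [coeff_exp]; simp

theorem coeff_pow_eq_zero_of_lt {R : Type*} [CommSemiring R] {g : R⟦X⟧}
    (hg : constantCoeff g = 0) {n k : ℕ} (h : n < k) : coeff n (g ^ k) = 0 := by
  obtain ⟨q, hq⟩ := X_dvd_iff.mpr hg
  rw [hq, mul_pow, coeff_X_pow_mul', if_neg (by omega)]

theorem coeff_subst_eq_sum {R : Type*} [CommRing R] (f : R⟦X⟧) {g : R⟦X⟧}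
    (hg : constantCoeff g = 0) (n : ℕ) :
    coeff n (f.subst g) = ∑ k ∈ Finset.range (n + 1), coeff k f * coeff n (g ^ k) := by
  rw [coeff_subst' (HasSubst.of_constantCoeff_zero' hg), finsum_eq_sum_of_support_subset]
  · rfl
  · intro k hk
    rw [Finset.coe_range, Set.mem_Iio]
    by_contra hlt
    exact hk (by
      show coeff k f • coeff n (g ^ k) = 0
      rw [coeff_pow_eq_zero_of_lt hg (by omega), smul_zero])

theorem Nonneg.subst {f g : ℝ⟦X⟧} (hf : f.Nonneg) (hg : g.Nonneg) (hg0 : constantCoeff g = 0) :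
    Nonneg (f.subst g) := fun n => by
  rw [coeff_subst_eq_sum f hg0]
  exact Finset.sum_nonneg fun k _ => mul_nonneg (hf k) (hg.pow k n)

theorem seriesValue_one (x : ℝ≥0∞) : seriesValue 1 x = 1 := by
  rw [seriesValue, tsum_eq_single 0]
  · simp
  · intro n hn; simp [coeff_one, hn]

theorem seriesValue_X (x : ℝ≥0∞) : seriesValue X x = x := by
  rw [seriesValue, tsum_eq_single 1]
  · simp
  · intro n hn; simp [coeff_X, hn]

theorem seriesValue_mul {f g : ℝ⟦X⟧} (hf : f.Nonneg) (hg : g.Nonneg) (x : ℝ≥0∞) :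
    seriesValue (f * g) x = seriesValue f x * seriesValue g x := by
  have h1 : seriesValue (f * g) x = ∑' n : ℕ, ∑' p : Finset.HasAntidiagonal.antidiagonal n,
      (ENNReal.ofReal (coeff p.1.1 f) * x ^ p.1.1) *
        (ENNReal.ofReal (coeff p.1.2 g) * x ^ p.1.2) := by
    refine tsum_congr fun n => ?_
    rw [tsum_fintype, coeff_mul, ENNReal.ofReal_sum_of_nonneg fun p _ => mul_nonneg (hf _) (hg _),
      Finset.sum_mul, ← Finset.sum_coe_sort]
    refine Finset.sum_congr rfl fun p _ => ?_
    obtain ⟨⟨i, j⟩, hp⟩ := p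
    obtain rfl : i + j = n := Finset.HasAntidiagonal.mem_antidiagonal.mp hp
    rw [ENNReal.ofReal_mul (hf _), pow_add]
    ring
  rw [h1, ← ENNReal.tsum_sigma' (fun q : Σ n : ℕ, Finset.HasAntidiagonal.antidiagonal n =>
    (ENNReal.ofReal (coeff q.2.1.1 f) * x ^ q.2.1.1) *
        (ENNReal.ofReal (coeff q.2.1.2 g) * x ^ q.2.1.2)),
    ← Equiv.tsum_eq Finset.HasAntidiagonal.sigmaAntidiagonalEquivProd.symm]
  simp only [Finset.HasAntidiagonal.sigmaAntidiagonalEquivProd_symm_apply_snd_coe]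
  rw [ENNReal.tsum_prod' (f := fun p : ℕ × ℕ => ENNReal.ofReal (coeff p.1 f) * x ^ p.1 *
    (ENNReal.ofReal (coeff p.2 g) * x ^ p.2))]
  simp_rw [ENNReal.tsum_mul_left, ENNReal.tsum_mul_right]
  rfl

theorem seriesValue_pow {f : ℝ⟦X⟧} (hf : f.Nonneg) (x : ℝ≥0∞) (k : ℕ) :
    seriesValue (f ^ k) x = seriesValue f x ^ k := by
  induction k with
  | zero => simp [seriesValue_one]
  | succ k ih => rw [pow_succ, pow_succ, seriesValue_mul (hf.pow k) hf, ih]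

theorem tsum_tsum_coeff_pow {f g : ℝ⟦X⟧} (hg : g.Nonneg) (x : ℝ≥0∞) :
    ∑' k : ℕ, ∑' n : ℕ, ENNReal.ofReal (coeff k f) * (ENNReal.ofReal (coeff n (g ^ k)) * x ^ n) =
      seriesValue f (seriesValue g x) := by
  refine tsum_congr fun k => ?_
  rw [ENNReal.tsum_mul_left, ← seriesValue_pow hg]
  rfl

/-- Tonelli in $[0,\infty]$: the double sum over the outer degree $k$ and the total degree $n$ may
be exchanged without any convergence hypothesis. For fixed $n$ only $k\le n$ contributes, since the
inner series has no constant term. -/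
theorem seriesValue_subst {f g : ℝ⟦X⟧} (hf : f.Nonneg) (hg : g.Nonneg)
    (hg0 : constantCoeff g = 0) (x : ℝ≥0∞) :
    seriesValue (f.subst g) x = seriesValue f (seriesValue g x) := by
  rw [← tsum_tsum_coeff_pow hg, ENNReal.tsum_comm]
  refine tsum_congr fun n => ?_
  rw [coeff_subst_eq_sum f hg0, ENNReal.ofReal_sum_of_nonneg
    fun k _ => mul_nonneg (hf k) (hg.pow k n), Finset.sum_mul, tsum_eq_sum (s := Finset.range (n + 1))]
  · exact Finset.sum_congr rfl fun k _ => by rw [ENNReal.ofReal_mul (hf k), mul_assoc]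
  · intro k hk
    rw [coeff_pow_eq_zero_of_lt hg0 (by simpa using hk)]; simp

theorem seriesValue_mono (f : ℝ⟦X⟧) {x y : ℝ≥0∞} (h : x ≤ y) : seriesValue f x ≤ seriesValue f y :=
  ENNReal.tsum_le_tsum fun _ => by gcongr

theorem summable_of_seriesValue_ne_top {f : ℝ⟦X⟧} (hf : f.Nonneg) {r : ℝ} (hr : 0 ≤ r)
    (h : seriesValue f (ENNReal.ofReal r) ≠ ⊤) : Summable fun n => coeff n f * r ^ n := by
  have h1 : ∀ n, ENNReal.ofReal (coeff n f) * ENNReal.ofReal r ^ n =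
      ENNReal.ofReal (coeff n f * r ^ n) := fun n => by
    rw [ENNReal.ofReal_mul (hf n), ENNReal.ofReal_pow hr]
  rw [seriesValue] at h
  simp_rw [h1] at h
  have := ENNReal.summable_toReal h
  refine this.congr fun n => ?_
  rw [ENNReal.toReal_ofReal (mul_nonneg (hf n) (pow_nonneg hr n))]

theorem seriesValue_eq_ofReal_tsum {f : ℝ⟦X⟧} (hf : f.Nonneg) {r : ℝ} (hr : 0 ≤ r)
    (h : Summable fun n => coeff n f * r ^ n) :
    seriesValue f (ENNReal.ofReal r) = ENNReal.ofReal (∑' n, coeff n f * r ^ n) := by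
  rw [ENNReal.ofReal_tsum_of_nonneg (fun n => mul_nonneg (hf n) (pow_nonneg hr n)) h]
  refine tsum_congr fun n => ?_
  rw [ENNReal.ofReal_mul (hf n), ENNReal.ofReal_pow hr]

theorem seriesValue_exp {r : ℝ} (hr : 0 ≤ r) :
    seriesValue (exp ℝ) (ENNReal.ofReal r) = ENNReal.ofReal (Real.exp r) := by
  have h : HasSum (fun n => coeff n (exp ℝ) * r ^ n) (Real.exp r) := by
    have := NormedSpace.expSeries_div_hasSum_exp r
    rw [← Real.exp_eq_exp_ℝ] at this
    refine this.congr_fun fun n => ?_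
    rw [coeff_exp]; simp [div_eq_inv_mul]
  rw [seriesValue_eq_ofReal_tsum nonneg_exp hr h.summable, h.tsum_eq]

/-! ### Complex evaluation -/

theorem hasSum_coeff_mul {f g : ℝ⟦X⟧} {z a b : ℂ}
    (hf : Summable fun n => |coeff n f| * ‖z‖ ^ n) (hg : Summable fun n => |coeff n g| * ‖z‖ ^ n)
    (ha : HasSum (fun n => ((coeff n f : ℝ) : ℂ) * z ^ n) a)
    (hb : HasSum (fun n => ((coeff n g : ℝ) : ℂ) * z ^ n) b) :
    HasSum (fun n => ((coeff n (f * g) : ℝ) : ℂ) * z ^ n) (a * b) := by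
  have hf' : Summable fun n => ‖((coeff n f : ℝ) : ℂ) * z ^ n‖ := by simpa using hf
  have hg' : Summable fun n => ‖((coeff n g : ℝ) : ℂ) * z ^ n‖ := by simpa using hg
  have h := tsum_mul_tsum_eq_tsum_sum_antidiagonal_of_summable_norm hf' hg'
  have hs := summable_norm_sum_mul_antidiagonal_of_summable_norm hf' hg'
  rw [ha.tsum_eq, hb.tsum_eq] at h
  rw [h]
  have he : (fun n => ((coeff n (f * g) : ℝ) : ℂ) * z ^ n) = fun n =>
      ∑ kl ∈ Finset.HasAntidiagonal.antidiagonal n, ((coeff kl.1 f : ℝ) : ℂ) * z ^ kl.1 * (((coeff kl.2 g : ℝ) : ℂ) * z ^ kl.2) := by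
    funext n
    rw [coeff_mul]
    push_cast
    rw [Finset.sum_mul]
    refine Finset.sum_congr rfl fun p hp => ?_
    rw [← Finset.HasAntidiagonal.mem_antidiagonal.mp hp, pow_add]; ring
  rw [he]
  exact hs.of_norm.hasSum

theorem hasSum_coeff_pow {f : ℝ⟦X⟧} (hf : f.Nonneg) {z a : ℂ}
    (hs : Summable fun n => coeff n f * ‖z‖ ^ n)
    (ha : HasSum (fun n => ((coeff n f : ℝ) : ℂ) * z ^ n) a) (k : ℕ) :
    HasSum (fun n => ((coeff n (f ^ k) : ℝ) : ℂ) * z ^ n) (a ^ k) := by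
  have hfin : ∀ k, Summable fun n => coeff n (f ^ k) * ‖z‖ ^ n := fun k =>
    summable_of_seriesValue_ne_top (hf.pow k) (norm_nonneg z) <| by
      rw [seriesValue_pow hf, seriesValue_eq_ofReal_tsum hf (norm_nonneg z) hs]
      exact ENNReal.pow_ne_top ENNReal.ofReal_ne_top
  induction k with
  | zero =>
    rw [pow_zero, pow_zero]
    have := hasSum_single (f := fun n => ((coeff n (1 : ℝ⟦X⟧) : ℝ) : ℂ) * z ^ n) 0
      fun n hn => by simp [coeff_one, hn]
    simpa using this
  | succ k ih =>
    rw [pow_succ, pow_succ]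
    refine hasSum_coeff_mul ?_ ?_ ih ha
    · exact (hfin k).congr fun n => by rw [abs_of_nonneg (hf.pow k n)]
    · exact hs.congr fun n => by rw [abs_of_nonneg (hf n)]

/-- The family indexed by outer degree and total degree is absolutely summable because its norms sum
to the value of the real composition at $\|z\|$; it may therefore be summed along either coordinate.
-/
theorem hasSum_coeff_subst {f g : ℝ⟦X⟧} (hf : f.Nonneg) (hg : g.Nonneg)
    (hg0 : constantCoeff g = 0) {z a b : ℂ} (hs : Summable fun n => coeff n g * ‖z‖ ^ n)
    (hfs : Summable fun n => coeff n f * (∑' m, coeff m g * ‖z‖ ^ m) ^ n)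
    (ha : HasSum (fun n => ((coeff n g : ℝ) : ℂ) * z ^ n) a)
    (hb : HasSum (fun n => ((coeff n f : ℝ) : ℂ) * a ^ n) b) :
    HasSum (fun n => ((coeff n (f.subst g) : ℝ) : ℂ) * z ^ n) b := by
  set F : ℕ × ℕ → ℂ := fun p => ((coeff p.1 f : ℝ) : ℂ) * (((coeff p.2 (g ^ p.1) : ℝ) : ℂ) * z ^ p.2)
  have hgs : 0 ≤ ∑' m, coeff m g * ‖z‖ ^ m := tsum_nonneg fun n => mul_nonneg (hg n) (by positivity)
  have hF : Summable F := by
    have hne : ∑' p : ℕ × ℕ, ENNReal.ofReal (coeff p.1 f) *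
        (ENNReal.ofReal (coeff p.2 (g ^ p.1)) * ENNReal.ofReal ‖z‖ ^ p.2) ≠ ⊤ := by
      rw [ENNReal.tsum_prod' (f := fun p : ℕ × ℕ => ENNReal.ofReal (coeff p.1 f) *
        (ENNReal.ofReal (coeff p.2 (g ^ p.1)) * ENNReal.ofReal ‖z‖ ^ p.2)),
        tsum_tsum_coeff_pow hg, seriesValue_eq_ofReal_tsum hg (norm_nonneg z) hs,
        seriesValue_eq_ofReal_tsum hf hgs hfs]
      exact ENNReal.ofReal_ne_top
    have := ENNReal.summable_toReal hne
    refine Summable.of_norm (this.congr fun p => ?_)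
    rw [ENNReal.toReal_mul, ENNReal.toReal_mul, ENNReal.toReal_pow, ENNReal.toReal_ofReal (hf _),
      ENNReal.toReal_ofReal (hg.pow _ _), ENNReal.toReal_ofReal (norm_nonneg _)]
    simp only [F, norm_mul, norm_pow, Complex.norm_real, Real.norm_eq_abs]
    rw [abs_of_nonneg (hf _), abs_of_nonneg (hg.pow _ _)]
  have hb' : HasSum F b := by
    have h1 : HasSum F (∑' p, F p) := hF.hasSum
    have h2 := h1.prod_fiberwise fun k => (hasSum_coeff_pow hg hs ha k).mul_left ((coeff k f : ℝ) : ℂ)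
    rwa [h2.unique hb] at h1
  have hswap : HasSum (F ∘ Prod.swap) b := (Equiv.prodComm ℕ ℕ).hasSum_iff.mpr hb'
  refine hswap.prod_fiberwise fun n => ?_
  have : ((coeff n (f.subst g) : ℝ) : ℂ) * z ^ n =
      ∑ k ∈ Finset.range (n + 1), (F ∘ Prod.swap) (n, k) := by
    rw [coeff_subst_eq_sum f hg0]
    push_cast
    rw [Finset.sum_mul]
    exact Finset.sum_congr rfl fun k _ => by simp [F, mul_assoc]
  rw [this]
  refine hasSum_sum_of_ne_finset_zero fun k hk => ?_
  simp only [F, Function.comp_apply, Prod.swap_prod_mk]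
  rw [coeff_pow_eq_zero_of_lt hg0 (by simpa using hk)]; simp

end PowerSeries

section Asymptotics

open Filter Topology MeasureTheory

/-! ### Fourier coefficients and Laplace's method -/

theorem intervalIntegral_exp_int_mul (m : ℤ) :
    ∫ θ in -Real.pi..Real.pi, Complex.exp (Complex.I * m * θ) =
      if m = 0 then (2 * Real.pi : ℂ) else 0 := by
  split_ifs with h
  · simp [h]; ring
  · have hc : Complex.I * (m : ℂ) ≠ 0 := mul_ne_zero Complex.I_ne_zero (by exact_mod_cast h)
    rw [integral_exp_mul_complex hc]
    have : Complex.exp (Complex.I * m * (Real.pi : ℝ)) =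
        Complex.exp (Complex.I * m * ((-Real.pi : ℝ) : ℂ)) := by
      rw [Complex.exp_eq_exp_iff_exists_int]
      exact ⟨m, by push_cast; ring⟩
    rw [this, sub_self, zero_div]

theorem intervalIntegral_fourier_coeff {c : ℕ → ℝ} (hc : Summable fun m => |c m|) {f : ℝ → ℂ}
    (hf : ∀ θ : ℝ, HasSum (fun m : ℕ => (c m : ℂ) * Complex.exp (Complex.I * m * θ)) (f θ)) (n : ℕ) :
    ∫ θ in -Real.pi..Real.pi, f θ * Complex.exp (-(Complex.I * n * θ)) = 2 * Real.pi * c n := by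
  have h := intervalIntegral.hasSum_integral_of_dominated_convergence (μ := volume)
    (a := -Real.pi) (b := Real.pi)
    (F := fun (m : ℕ) (θ : ℝ) => (c m : ℂ) * Complex.exp (Complex.I * m * θ) *
      Complex.exp (-(Complex.I * n * θ))) (f := fun θ => f θ * Complex.exp (-(Complex.I * n * θ)))
    (fun m _ => |c m|) (fun m => by fun_prop)
    (fun m => Eventually.of_forall fun θ _ => by
      have h1 : ‖Complex.exp (Complex.I * m * θ)‖ = 1 := by
        rw [Complex.norm_exp]; simp
      have h2 : ‖Complex.exp (-(Complex.I * n * θ))‖ = 1 := by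
        rw [Complex.norm_exp]; simp
      rw [norm_mul, norm_mul, h1, h2]; simp)
    (Eventually.of_forall fun θ _ => hc) (by simp)
    (Eventually.of_forall fun θ _ => (hf θ).mul_right _)
  refine h.unique ?_
  have he : ∀ m : ℕ, ∫ θ in -Real.pi..Real.pi, (c m : ℂ) * Complex.exp (Complex.I * m * θ) *
      Complex.exp (-(Complex.I * n * θ)) = if m = n then 2 * Real.pi * (c n : ℂ) else 0 := by
    intro m
    have : ∀ θ : ℝ, (c m : ℂ) * Complex.exp (Complex.I * m * θ) *
        Complex.exp (-(Complex.I * n * θ)) =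
        c m * Complex.exp (Complex.I * ((m - n : ℤ) : ℂ) * θ) := fun θ => by
      rw [mul_assoc, ← Complex.exp_add]; congr 2; push_cast; ring
    simp_rw [this]
    rw [intervalIntegral.integral_const_mul, intervalIntegral_exp_int_mul]
    by_cases hmn : m = n
    · subst hmn; simp; ring
    · rw [if_neg hmn, if_neg (by omega), mul_zero]
  simp_rw [he]
  exact hasSum_ite_eq n _

/-- A crude bound valid for every real $x$; it supplies the majorant $k^2p_k$ for dominated
convergence of the exponent. -/
theorem norm_exp_I_mul_sub_one_sub_le (x : ℝ) :
    ‖Complex.exp (Complex.I * x) - 1 - Complex.I * x‖ ≤ 2 * x ^ 2 := by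
  rcases le_or_gt |x| 1 with h | h
  · have := Complex.norm_exp_sub_one_sub_id_le (x := Complex.I * x) (by simpa using h)
    have hx : ‖Complex.I * (x : ℂ)‖ ^ 2 = x ^ 2 := by simp
    rw [hx] at this
    nlinarith [sq_nonneg x]
  · have h1 := norm_sub_le (Complex.exp (Complex.I * x) - 1) (Complex.I * x)
    have h2 : ‖Complex.exp (Complex.I * x) - 1‖ ≤ |x| := Real.norm_exp_I_mul_ofReal_sub_one_le
    have h3 : ‖Complex.I * (x : ℂ)‖ = |x| := by simp
    rw [← sq_abs]
    nlinarith

theorem tendsto_mul_exp_I_mul_sub_one_sub (s : ℝ) :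
    Tendsto (fun n : ℕ => ((n : ℂ) + 1) * (Complex.exp (Complex.I * ((s / √(n + 1) : ℝ) : ℂ)) - 1 -
      Complex.I * ((s / √(n + 1) : ℝ) : ℂ))) atTop (𝓝 (-(s ^ 2 / 2 : ℝ))) := by
  have hsqrt : Tendsto (fun n : ℕ => √((n : ℝ) + 1)) atTop atTop :=
    Real.tendsto_sqrt_atTop.comp (tendsto_atTop_add_const_right _ _ tendsto_natCast_atTop_atTop)
  have hx : Tendsto (fun n : ℕ => |s| / √((n : ℝ) + 1)) atTop (𝓝 0) :=
    hsqrt.const_div_atTop _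
  rw [tendsto_iff_norm_sub_tendsto_zero]
  have hlim : Tendsto (fun n : ℕ => |s| ^ 2 * (|s| / √((n : ℝ) + 1) *
      Real.exp (|s| / √((n : ℝ) + 1)))) atTop (𝓝 0) := by
    have := (hx.mul (Real.continuous_exp.continuousAt.tendsto.comp hx)).const_mul (|s| ^ 2)
    simpa using this
  refine squeeze_zero (fun n => norm_nonneg _) (fun n => ?_) hlim
  set r : ℝ := √((n : ℝ) + 1) with hr
  have hr0 : 0 < r := Real.sqrt_pos.mpr (by positivity)
  have hr2 : (r : ℂ) ^ 2 = n + 1 := by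
    have : r ^ 2 = n + 1 := Real.sq_sqrt (by positivity)
    exact_mod_cast this
  have hrC : (r : ℂ) ≠ 0 := by exact_mod_cast hr0.ne'
  set z : ℂ := Complex.I * ((s / r : ℝ) : ℂ) with hz
  have hzn : ‖z‖ = |s| / r := by rw [hz]; simp [abs_of_pos hr0]
  have h3 := Complex.norm_exp_sub_sum_le_norm_mul_exp z 3
  have he : ((n : ℂ) + 1) * (Complex.exp z - 1 - z) - ((-(s ^ 2 / 2 : ℝ) : ℝ) : ℂ) =
      (r : ℂ) ^ 2 * (Complex.exp z - ∑ m ∈ Finset.range 3, z ^ m / m.factorial) := by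
    have hz2 : z ^ 2 = -(s ^ 2 / r ^ 2) := by
      rw [hz, mul_pow, Complex.I_sq]; push_cast; rw [div_pow]; ring
    simp only [Finset.sum_range_succ, Finset.sum_range_zero, Nat.factorial]
    rw [hz2, ← hr2]
    push_cast
    field_simp
    ring
  have he' : ((n : ℂ) + 1) * (Complex.exp z - 1 - z) - (-((s ^ 2 / 2 : ℝ) : ℂ)) =
      (r : ℂ) ^ 2 * (Complex.exp z - ∑ m ∈ Finset.range 3, z ^ m / m.factorial) := by
    rw [← he]; push_cast; ring
  rw [he', norm_mul, norm_pow, Complex.norm_real, Real.norm_of_nonneg hr0.le]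
  calc r ^ 2 * ‖Complex.exp z - ∑ m ∈ Finset.range 3, z ^ m / m.factorial‖
      ≤ r ^ 2 * (‖z‖ ^ 3 * Real.exp ‖z‖) := by gcongr
    _ = |s| ^ 2 * (|s| / r * Real.exp (|s| / r)) := by
      rw [hzn]; field_simp

section Laplace

variable {p : ℕ → ℝ}

theorem summable_mul_exp_I (hp : ∀ k, 0 ≤ p k) (hs : Summable p) (θ : ℝ) :
    Summable fun k : ℕ => (p k : ℂ) * Complex.exp (Complex.I * k * θ) := by
  refine Summable.of_norm (hs.congr fun k => ?_)
  have h1 : ‖Complex.exp (Complex.I * k * θ)‖ = 1 := by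
    rw [Complex.norm_exp]; simp
  rw [norm_mul, h1, mul_one, Complex.norm_real, Real.norm_of_nonneg (hp k)]

theorem continuous_tsum_mul_exp_I (hp : ∀ k, 0 ≤ p k) (hs : Summable p) :
    Continuous fun θ : ℝ => ∑' k : ℕ, (p k : ℂ) * Complex.exp (Complex.I * k * θ) := by
  refine continuous_tsum (fun k => by fun_prop) hs fun k θ => ?_
  have h1 : ‖Complex.exp (Complex.I * k * θ)‖ = 1 := by
    rw [Complex.norm_exp]; simp
  rw [norm_mul, h1, mul_one, Complex.norm_real, Real.norm_of_nonneg (hp k)]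

/-- Every term $p_k(\cos k\theta-1)$ is nonpositive, so all but $k=1$ can be dropped; the remaining
one satisfies $\cos\theta\le 1-2\theta^2/\pi^2$ on $[-\pi,\pi]$. This is where $p_1>0$ will exclude
other maxima on the circle. -/
theorem re_tsum_mul_exp_I_sub_le (hp : ∀ k, 0 ≤ p k) (hs : Summable p) {θ : ℝ}
    (hθ : |θ| ≤ Real.pi) :
    (∑' k : ℕ, (p k : ℂ) * Complex.exp (Complex.I * k * θ)).re - ∑' k, p k ≤
      -(p 1 * (2 / Real.pi ^ 2) * θ ^ 2) := by
  have hre := Complex.hasSum_re (summable_mul_exp_I hp hs θ).hasSum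
  have hre' : ∀ k : ℕ, ((p k : ℂ) * Complex.exp (Complex.I * k * θ)).re = p k * Real.cos (k * θ) := by
    intro k
    have : Complex.I * k * θ = ((k * θ : ℝ) : ℂ) * Complex.I := by push_cast; ring
    rw [this, Complex.re_ofReal_mul, Complex.exp_ofReal_mul_I_re]
  simp_rw [hre'] at hre
  have hd := (hs.hasSum).sub hre
  have h1 : p 1 - p 1 * Real.cos ((1 : ℕ) * θ) ≤ _ :=
    le_hasSum hd 1 fun k _ => by nlinarith [hp k, Real.cos_le_one (k * θ)]
  have h2 := Real.cos_le_one_sub_mul_cos_sq hθ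
  rw [Nat.cast_one, one_mul] at h1
  nlinarith [hp 1]

theorem tendsto_laplace_exponent (hp : ∀ k, 0 ≤ p k) (hs : Summable p)
    (hs2 : Summable fun k : ℕ => (k : ℝ) ^ 2 * p k) (hcrit : HasSum (fun k : ℕ => (k : ℝ) * p k) 1)
    (t : ℝ) :
    Tendsto (fun n : ℕ => ((n : ℂ) + 1) *
        ((∑' k : ℕ, (p k : ℂ) * Complex.exp (Complex.I * k * ((t / √(n + 1) : ℝ) : ℂ))) -
          ((∑' k, p k : ℝ) : ℂ)) - Complex.I * n * ((t / √(n + 1) : ℝ) : ℂ)) atTop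
      (𝓝 ((-((∑' k : ℕ, (k : ℝ) ^ 2 * p k) / 2) * t ^ 2 : ℝ) : ℂ)) := by
  have hterm : Tendsto (fun n : ℕ => ∑' k : ℕ, (p k : ℂ) * (((n : ℂ) + 1) *
      (Complex.exp (Complex.I * ((k * t / √(n + 1) : ℝ) : ℂ)) - 1 -
      Complex.I * ((k * t / √(n + 1) : ℝ) : ℂ)))) atTop
      (𝓝 (∑' k : ℕ, (p k : ℂ) * (-((k * t) ^ 2 / 2 : ℝ)))) := by
    refine tendsto_tsum_of_dominated_convergence
      (bound := fun k : ℕ => 2 * t ^ 2 * ((k : ℝ) ^ 2 * p k)) (hs2.mul_left _)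
      (fun k => (tendsto_mul_exp_I_mul_sub_one_sub (k * t)).const_mul _)
      (Eventually.of_forall fun n k => ?_)
    rw [norm_mul, norm_mul, Complex.norm_real, Real.norm_of_nonneg (hp k)]
    have hn : ‖(n : ℂ) + 1‖ = (n : ℝ) + 1 := by
      have : ((n : ℂ) + 1) = ((n + 1 : ℕ) : ℂ) := by push_cast; ring
      rw [this, Complex.norm_natCast]; push_cast; ring
    rw [hn]
    have h := norm_exp_I_mul_sub_one_sub_le (k * t / √((n : ℝ) + 1))
    rw [div_pow, Real.sq_sqrt (by positivity)] at h
    calc p k * (((n : ℝ) + 1) * _) ≤ p k * (((n : ℝ) + 1) * (2 * ((k * t) ^ 2 / ((n : ℝ) + 1)))) := by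
          have := hp k
          gcongr
      _ = _ := by field_simp
  -- The first moment being 1, the linear terms contribute $(n+1)i\theta-ni\theta=i\theta$; this
  -- single leftover tends to 0 at scale $t/\sqrt{n+1}$.
  have hlin : Tendsto (fun n : ℕ => Complex.I * ((t / √((n : ℝ) + 1) : ℝ) : ℂ)) atTop (𝓝 0) := by
    have hsqrt : Tendsto (fun n : ℕ => √((n : ℝ) + 1)) atTop atTop :=
      Real.tendsto_sqrt_atTop.comp (tendsto_atTop_add_const_right _ _ tendsto_natCast_atTop_atTop)
    have h0 : Tendsto (fun n : ℕ => t / √((n : ℝ) + 1)) atTop (𝓝 0) := hsqrt.const_div_atTop _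
    have := ((Complex.continuous_ofReal.tendsto 0).comp h0).const_mul Complex.I
    simpa using this
  have hsum := hterm.add hlin
  have hval : (∑' k : ℕ, (p k : ℂ) * (-((k * t) ^ 2 / 2 : ℝ))) + 0 =
      ((-((∑' k : ℕ, (k : ℝ) ^ 2 * p k) / 2) * t ^ 2 : ℝ) : ℂ) := by
    rw [add_zero, neg_mul, Complex.ofReal_neg, div_mul_eq_mul_div, mul_div_assoc, ← tsum_mul_right,
      Complex.ofReal_tsum, ← tsum_neg]
    refine tsum_congr fun k => ?_
    push_cast; ring
  rw [hval] at hsum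
  refine hsum.congr fun n => ?_
  set θ : ℝ := t / √((n : ℝ) + 1) with hθ
  have hθk : ∀ k : ℕ, ((k * t / √((n : ℝ) + 1) : ℝ) : ℂ) = k * (θ : ℂ) := fun k => by
    rw [hθ]; push_cast; ring
  have h1 := (summable_mul_exp_I hp hs θ).hasSum
  have h2 : HasSum (fun k : ℕ => (p k : ℂ)) ((∑' k, p k : ℝ) : ℂ) := by
    exact_mod_cast Complex.hasSum_ofReal.mpr hs.hasSum
  have h3 : HasSum (fun k : ℕ => (k : ℂ) * (p k : ℂ)) (1 : ℂ) := by
    have := Complex.hasSum_ofReal.mpr hcrit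
    simpa only [Complex.ofReal_mul, Complex.ofReal_natCast, Complex.ofReal_one] using this
  have h4 := (((h1.sub h2).sub (h3.mul_right (Complex.I * θ))).mul_left ((n : ℂ) + 1)).tsum_eq
  have h5 := h4.symm.trans (tsum_congr (g := fun k : ℕ => (p k : ℂ) * (((n : ℂ) + 1) *
      (Complex.exp (Complex.I * ((k * t / √((n : ℝ) + 1) : ℝ) : ℂ)) - 1 -
      Complex.I * ((k * t / √((n : ℝ) + 1) : ℝ) : ℂ)))) fun k => by
    rw [hθk, ← mul_assoc Complex.I]
    ring)
  rw [← h5]; ring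

theorem tendsto_sqrt_mul_integral (hp : ∀ k, 0 ≤ p k) (hs : Summable p) (hp1 : 0 < p 1)
    (hs2 : Summable fun k : ℕ => (k : ℝ) ^ 2 * p k) (hcrit : HasSum (fun k : ℕ => (k : ℝ) * p k) 1) :
    Tendsto (fun n : ℕ => ((√((n : ℝ) + 1) : ℝ) : ℂ) * ∫ θ in -Real.pi..Real.pi,
      Complex.exp (((n : ℂ) + 1) * ((∑' k : ℕ, (p k : ℂ) * Complex.exp (Complex.I * k * (θ : ℂ))) -
        ((∑' k, p k : ℝ) : ℂ)) - Complex.I * n * (θ : ℂ))) atTop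
      (𝓝 ((√(Real.pi / ((∑' k : ℕ, (k : ℝ) ^ 2 * p k) / 2)) : ℝ) : ℂ)) := by
  set w : ℝ → ℂ := fun θ => ∑' k : ℕ, (p k : ℂ) * Complex.exp (Complex.I * k * (θ : ℂ)) with hw
  set P : ℝ := ∑' k, p k
  set E : ℕ → ℝ → ℂ := fun n θ =>
    Complex.exp (((n : ℂ) + 1) * (w θ - (P : ℂ)) - Complex.I * n * (θ : ℂ)) with hE
  have hwc : Continuous w := continuous_tsum_mul_exp_I hp hs
  have hEc : ∀ n, Continuous (E n) := fun n => by
    simp only [hE]; fun_prop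
  -- The substitution $\theta=t/\sqrt{n+1}$, with the integrand cut off so that all integrals are
  -- over $\mathbb R$. The quadratic bound on the real part gives one Gaussian majorant for all $n$.
  set F : ℕ → ℝ → ℂ := fun n => (Set.Ioc (-(Real.pi * √((n : ℝ) + 1)))
    (Real.pi * √((n : ℝ) + 1))).indicator fun t => E n (t / √((n : ℝ) + 1)) with hF
  have hFint : ∀ n : ℕ, ((√((n : ℝ) + 1) : ℝ) : ℂ) * ∫ θ in -Real.pi..Real.pi, E n θ =
      ∫ t, F n t := by
    intro n
    have hr : 0 < √((n : ℝ) + 1) := Real.sqrt_pos.mpr (by positivity)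
    rw [hF, integral_indicator measurableSet_Ioc, ← intervalIntegral.integral_of_le
      (by nlinarith [Real.pi_pos]), intervalIntegral.integral_comp_div _ hr.ne', neg_div,
      mul_div_cancel_right₀ _ hr.ne', Complex.real_smul]
  have hlim : Tendsto (fun n => ∫ t, F n t) atTop
      (𝓝 (∫ t : ℝ, ((Real.exp (-((∑' k : ℕ, (k : ℝ) ^ 2 * p k) / 2) * t ^ 2) : ℝ) : ℂ))) := by
    refine tendsto_integral_of_dominated_convergence
      (fun t => Real.exp (-(p 1 * (2 / Real.pi ^ 2)) * t ^ 2)) (fun n => ?_)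
      (integrable_exp_neg_mul_sq (by positivity)) (fun n => Eventually.of_forall fun t => ?_)
      (Eventually.of_forall fun t => ?_)
    · refine (Continuous.aestronglyMeasurable ?_).indicator measurableSet_Ioc
      have := hEc n
      fun_prop
    · have hr : 0 < √((n : ℝ) + 1) := Real.sqrt_pos.mpr (by positivity)
      simp only [hF]
      by_cases ht : t ∈ Set.Ioc (-(Real.pi * √((n : ℝ) + 1))) (Real.pi * √((n : ℝ) + 1))
      · rw [Set.indicator_of_mem ht]
        have hθ : |t / √((n : ℝ) + 1)| ≤ Real.pi := by
          rw [abs_div, abs_of_pos hr, div_le_iff₀ hr, abs_le]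
          exact ⟨ht.1.le, ht.2⟩
        have h := re_tsum_mul_exp_I_sub_le hp hs hθ
        simp only [hE]
        rw [Complex.norm_exp, Real.exp_le_exp]
        have hre : (((n : ℂ) + 1) * (w (t / √((n : ℝ) + 1)) - (P : ℂ)) -
            Complex.I * n * ((t / √((n : ℝ) + 1) : ℝ) : ℂ)).re =
            ((n : ℝ) + 1) * ((w (t / √((n : ℝ) + 1))).re - P) := by
          have : ((n : ℂ) + 1) = (((n : ℝ) + 1 : ℝ) : ℂ) := by push_cast; ring
          rw [this, Complex.sub_re, Complex.re_ofReal_mul]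
          simp
        rw [hre]
        calc ((n : ℝ) + 1) * ((w (t / √((n : ℝ) + 1))).re - P) ≤
            ((n : ℝ) + 1) * (-(p 1 * (2 / Real.pi ^ 2) * (t / √((n : ℝ) + 1)) ^ 2)) := by gcongr
          _ = _ := by
            rw [div_pow, Real.sq_sqrt (by positivity)]; field_simp
      · rw [Set.indicator_of_notMem ht, norm_zero]
        positivity
    · have h := (Complex.continuous_exp.tendsto _).comp
        (tendsto_laplace_exponent hp hs hs2 hcrit t)
      rw [← Complex.ofReal_exp] at h
      refine h.congr' ?_
      have hsqrt : Tendsto (fun n : ℕ => Real.pi * √((n : ℝ) + 1)) atTop atTop :=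
        (Real.tendsto_sqrt_atTop.comp (tendsto_atTop_add_const_right _ _
          tendsto_natCast_atTop_atTop)).const_mul_atTop Real.pi_pos
      filter_upwards [hsqrt.eventually_gt_atTop |t|] with n hn
      simp only [hF]
      have hmem : t ∈ Set.Ioc (-(Real.pi * √((n : ℝ) + 1))) (Real.pi * √((n : ℝ) + 1)) :=
        ⟨(abs_lt.mp hn).1, (abs_lt.mp hn).2.le⟩
      rw [Set.indicator_of_mem hmem]
      rfl
  rw [integral_complex_ofReal, integral_gaussian] at hlim
  refine hlim.congr fun n => (hFint n).symm

end Laplace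

/-! ### Coefficients of large powers at a saddle point. -/

namespace PowerSeries

/-- The saddle point asymptotics of `[uⁿ] exp(b(u))ⁿ⁺¹` at a critical point `τ`. -/
theorem exists_tendsto_coeff_exp_subst_pow {b : ℝ⟦X⟧} (hb : b.Nonneg) (hb0 : constantCoeff b = 0)
    (hb1 : 0 < coeff 1 b) {τ : ℝ} (hτ : 0 < τ) (hs : Summable fun k => coeff k b * τ ^ k)
    (hs2 : Summable fun k : ℕ => (k : ℝ) ^ 2 * (coeff k b * τ ^ k))
    (hcrit : HasSum (fun k : ℕ => (k : ℝ) * (coeff k b * τ ^ k)) 1) :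
    ∃ c : ℝ, 0 < c ∧ Tendsto (fun n : ℕ => √((n : ℝ) + 1) *
      (coeff n (((exp ℝ).subst b) ^ (n + 1)) * τ ^ n /
        Real.exp (∑' k, coeff k b * τ ^ k) ^ (n + 1))) atTop (𝓝 c) := by
  set p : ℕ → ℝ := fun k => coeff k b * τ ^ k with hpdef
  have hp : ∀ k, 0 ≤ p k := fun k => mul_nonneg (hb k) (pow_nonneg hτ.le k)
  have hp1 : 0 < p 1 := mul_pos hb1 (pow_pos hτ 1)
  set φ : ℝ⟦X⟧ := (exp ℝ).subst b with hφ
  have hφn : φ.Nonneg := nonneg_exp.subst hb hb0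
  set σ2 : ℝ := ∑' k : ℕ, (k : ℝ) ^ 2 * p k
  have hσ : 0 < σ2 := by
    have := hs2.sum_le_tsum {1} fun k _ => mul_nonneg (sq_nonneg _) (hp k)
    simp only [Finset.sum_singleton, Nat.cast_one, one_pow, one_mul] at this
    exact hp1.trans_le this
  have hexps : ∀ r : ℝ, Summable fun n => coeff n (exp ℝ) * r ^ n := fun r => by
    have := NormedSpace.expSeries_div_summable r
    refine this.congr fun n => ?_
    rw [coeff_exp]; simp [div_eq_inv_mul]
  -- On the circle of radius $\tau$ the power $\varphi^N$ takes the value $e^{Nb(z)}$, and its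
  -- coefficients weighted by $\tau^m$ are the Fourier coefficients.
  have heval : ∀ (θ : ℝ) (N : ℕ), HasSum (fun m : ℕ => ((coeff m (φ ^ N) * τ ^ m : ℝ) : ℂ) *
      Complex.exp (Complex.I * m * θ))
      (Complex.exp (N * ∑' k : ℕ, (p k : ℂ) * Complex.exp (Complex.I * k * θ))) := by
    intro θ N
    set z : ℂ := τ * Complex.exp (Complex.I * θ) with hz
    have hzn : ‖z‖ = τ := by
      rw [hz, norm_mul, Complex.norm_real, Real.norm_of_nonneg hτ.le, Complex.norm_exp]; simp
    have hzk : ∀ k : ℕ, z ^ k = (τ : ℂ) ^ k * Complex.exp (Complex.I * k * θ) := fun k => by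
      rw [hz, mul_pow, ← Complex.exp_nat_mul]; congr 2; ring
    have hbz : HasSum (fun k => ((coeff k b : ℝ) : ℂ) * z ^ k)
        (∑' k : ℕ, (p k : ℂ) * Complex.exp (Complex.I * k * θ)) := by
      refine (summable_mul_exp_I hp hs θ).hasSum.congr_fun fun k => ?_
      rw [hzk, hpdef]; push_cast; ring
    have hex : ∀ a : ℂ, HasSum (fun n => ((coeff n (exp ℝ) : ℝ) : ℂ) * a ^ n) (Complex.exp a) := by
      intro a
      have := NormedSpace.expSeries_div_hasSum_exp a
      rw [← Complex.exp_eq_exp_ℂ] at this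
      refine this.congr_fun fun n => ?_
      rw [coeff_exp]; simp [div_eq_inv_mul]
    have hφz := hasSum_coeff_subst nonneg_exp hb hb0 (z := z) (by rw [hzn]; exact hs)
      (hexps _) hbz (hex _)
    have hφs : Summable fun n => coeff n φ * ‖z‖ ^ n := by
      rw [hzn]
      refine summable_of_seriesValue_ne_top hφn hτ.le ?_
      rw [hφ, seriesValue_subst nonneg_exp hb hb0, seriesValue_eq_ofReal_tsum hb hτ.le hs,
        seriesValue_exp (tsum_nonneg hp)]
      exact ENNReal.ofReal_ne_top
    have h := hasSum_coeff_pow hφn hφs hφz N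
    rw [← Complex.exp_nat_mul] at h
    refine h.congr_fun fun m => ?_
    rw [hzk]; push_cast; ring
  have habs : ∀ N : ℕ, Summable fun m : ℕ => |coeff m (φ ^ N) * τ ^ m| := by
    intro N
    have := (heval 0 N).summable.norm
    refine this.congr fun m => ?_
    simp
  have hlap := tendsto_sqrt_mul_integral hp hs hp1 hs2 hcrit
  have hint : ∀ n : ℕ, ∫ θ in -Real.pi..Real.pi,
      Complex.exp (((n : ℂ) + 1) * ((∑' k : ℕ, (p k : ℂ) * Complex.exp (Complex.I * k * (θ : ℂ))) -
        ((∑' k, p k : ℝ) : ℂ)) - Complex.I * n * (θ : ℂ)) =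
      ((2 * Real.pi * (coeff n (φ ^ (n + 1)) * τ ^ n / Real.exp (∑' k, p k) ^ (n + 1)) : ℝ) : ℂ) := by
    intro n
    have h := intervalIntegral_fourier_coeff (habs (n + 1)) (fun θ => heval θ (n + 1)) n
    have he : ∀ θ : ℝ, Complex.exp (((n : ℂ) + 1) *
        ((∑' k : ℕ, (p k : ℂ) * Complex.exp (Complex.I * k * (θ : ℂ))) -
        ((∑' k, p k : ℝ) : ℂ)) - Complex.I * n * (θ : ℂ)) =
        (Complex.exp (((n + 1 : ℕ) : ℂ) * ∑' k : ℕ, (p k : ℂ) * Complex.exp (Complex.I * k * (θ : ℂ))) *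
          Complex.exp (-(Complex.I * n * θ))) * ((Real.exp (∑' k, p k) ^ (n + 1) : ℝ) : ℂ)⁻¹ := by
      intro θ
      rw [← Real.exp_nat_mul, Complex.ofReal_exp, ← Complex.exp_neg, ← Complex.exp_add,
        ← Complex.exp_add]
      congr 1
      push_cast
      ring
    simp_rw [he]
    rw [intervalIntegral.integral_mul_const, h]
    push_cast
    ring
  simp_rw [hint] at hlap
  -- The Gaussian integral divided by $2\pi$, that is $1/\sqrt{2\pi\sigma^2}$ where $\sigma^2$ is
  -- the second moment of $p$.
  refine ⟨√(Real.pi / (σ2 / 2)) / (2 * Real.pi), by positivity, ?_⟩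
  have hre := (Complex.continuous_re.tendsto _).comp hlap
  rw [Complex.ofReal_re] at hre
  refine (hre.div_const (2 * Real.pi)).congr fun n => ?_
  simp only [Function.comp_apply]
  rw [← Complex.ofReal_mul, Complex.ofReal_re]
  field_simp

end PowerSeries

namespace PowerSeries

/-! ### Radius of convergence -/

theorem ofReal_le_seriesRadius {f : ℝ⟦X⟧} (hf : f.Nonneg) {r C : ℝ} (hr : 0 ≤ r)
    (h : ∀ n, coeff n f * r ^ n ≤ C) : ENNReal.ofReal r ≤ seriesRadius f := by
  refine FormalMultilinearSeries.le_radius_of_bound _ C (r := r.toNNReal) fun n => ?_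
  rw [FormalMultilinearSeries.ofScalars_norm, Real.norm_of_nonneg (hf n), Real.coe_toNNReal _ hr]
  exact h n

theorem exists_bound_of_lt_seriesRadius {f : ℝ⟦X⟧} (hf : f.Nonneg) {r : ℝ} (hr : 0 ≤ r)
    (h : ENNReal.ofReal r < seriesRadius f) : ∃ C, ∀ n, coeff n f * r ^ n ≤ C := by
  obtain ⟨C, -, hC⟩ := FormalMultilinearSeries.norm_mul_pow_le_of_lt_radius _ (r := r.toNNReal) h
  refine ⟨C, fun n => ?_⟩
  have := hC n
  rwa [FormalMultilinearSeries.ofScalars_norm, Real.norm_of_nonneg (hf n),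
    Real.coe_toNNReal _ hr] at this

/-- Coefficients are bounded at some radius $R>r$ still inside the disc, so the series is dominated
by $n^k(r/R)^n$. -/
theorem summable_pow_mul_coeff_of_lt_seriesRadius {f : ℝ⟦X⟧} (hf : f.Nonneg) {r : ℝ} (hr : 0 ≤ r)
    (h : ENNReal.ofReal r < seriesRadius f) (k : ℕ) :
    Summable fun n : ℕ => (n : ℝ) ^ k * (coeff n f * r ^ n) := by
  obtain ⟨R, hrR, hR⟩ := ENNReal.lt_iff_exists_nnreal_btwn.mp h
  have hrR' : r < R := by
    have := (ENNReal.ofReal_lt_iff_lt_toReal hr ENNReal.coe_ne_top).mp hrR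
    simpa using this
  have hR0 : (0 : ℝ) < R := hr.trans_lt hrR'
  obtain ⟨C, hC⟩ := exists_bound_of_lt_seriesRadius hf R.2 (by simpa using hR)
  have hq : ‖r / R‖ < 1 := by
    rw [Real.norm_of_nonneg (by positivity), div_lt_one hR0]; exact hrR'
  refine Summable.of_nonneg_of_le (fun n => ?_) (fun n => ?_)
    ((summable_pow_mul_geometric_of_norm_lt_one k hq).mul_left C)
  · exact mul_nonneg (by positivity) (mul_nonneg (hf n) (by positivity))
  · have h1 : coeff n f * r ^ n = coeff n f * (R : ℝ) ^ n * (r / R) ^ n := by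
      rw [div_pow]; field_simp
    rw [h1]
    calc (n : ℝ) ^ k * (coeff n f * (R : ℝ) ^ n * (r / R) ^ n)
        = coeff n f * (R : ℝ) ^ n * ((n : ℝ) ^ k * (r / R) ^ n) := by ring
      _ ≤ C * ((n : ℝ) ^ k * (r / R) ^ n) := by
          have : 0 ≤ (n : ℝ) ^ k * (r / R) ^ n := by positivity
          exact mul_le_mul_of_nonneg_right (hC n) this

theorem summable_of_lt_seriesRadius {f : ℝ⟦X⟧} (hf : f.Nonneg) {r : ℝ} (hr : 0 ≤ r)
    (h : ENNReal.ofReal r < seriesRadius f) : Summable fun n : ℕ => coeff n f * r ^ n := by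
  simpa using summable_pow_mul_coeff_of_lt_seriesRadius hf hr h 0

/-! ### The characteristic system -/

/-- Convexity of $t\mapsto b(e^t)$: the slope of the chord is at most the derivative at the right
end. Termwise it is $1-e^{-s}\le s$ with $s=n\log(u/v)$. -/
theorem tsum_coeff_sub_le {b : ℝ⟦X⟧} (hb : b.Nonneg) {u v : ℝ} (hv : 0 < v) (hvu : v ≤ u)
    (hs : Summable fun n => coeff n b * u ^ n)
    (hs1 : Summable fun n : ℕ => (n : ℝ) * (coeff n b * u ^ n)) :
    (∑' n, coeff n b * u ^ n) - ∑' n, coeff n b * v ^ n ≤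
      (∑' n : ℕ, (n : ℝ) * (coeff n b * u ^ n)) * Real.log (u / v) := by
  have hu : 0 < u := hv.trans_le hvu
  have hsv : Summable fun n => coeff n b * v ^ n :=
    Summable.of_nonneg_of_le (fun n => mul_nonneg (hb n) (by positivity))
      (fun n => mul_le_mul_of_nonneg_left (pow_le_pow_left₀ hv.le hvu n) (hb n)) hs
  rw [← hs.tsum_sub hsv, ← tsum_mul_right]
  refine (hs.sub hsv).tsum_le_tsum (fun n => ?_) (hs1.mul_right _)
  have h1 : (v / u) ^ n = Real.exp (-(n * Real.log (u / v))) := by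
    rw [← Real.log_pow, ← Real.log_inv, Real.exp_log (by positivity), ← inv_pow, inv_div]
  have h2 : 1 - (v / u) ^ n ≤ n * Real.log (u / v) := by
    rw [h1]; linarith [Real.add_one_le_exp (-(n * Real.log (u / v)))]
  have h3 : v ^ n = u ^ n * (v / u) ^ n := by rw [div_pow]; field_simp
  rw [h3]
  have h4 : 0 ≤ coeff n b * u ^ n := mul_nonneg (hb n) (by positivity)
  nlinarith

variable {b y : ℝ⟦X⟧}

theorem continuousOn_tsum_coeff (hb : b.Nonneg) {u : ℝ}
    (hs : Summable fun n : ℕ => (n : ℝ) * (coeff n b * u ^ n)) :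
    ContinuousOn (fun v : ℝ => ∑' n : ℕ, (n : ℝ) * (coeff n b * v ^ n)) (Set.Icc 0 u) := by
  refine continuousOn_tsum (fun n => by fun_prop) hs fun n v hv => ?_
  have := hv.1
  rw [Real.norm_of_nonneg (mul_nonneg n.cast_nonneg (mul_nonneg (hb n) (by positivity)))]
  have := hb n
  gcongr
  exact hv.2

/-- A single term of a nonnegative series is at most its value, here $e^{Nb(u)}$. -/
theorem coeff_exp_subst_pow_mul_le (hb : b.Nonneg) (hb0 : constantCoeff b = 0) {u : ℝ} (hu : 0 ≤ u)
    (hs : Summable fun n => coeff n b * u ^ n) (n N : ℕ) :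
    coeff n (((exp ℝ).subst b) ^ N) * u ^ n ≤ Real.exp (∑' k, coeff k b * u ^ k) ^ N := by
  set φ : ℝ⟦X⟧ := (exp ℝ).subst b with hφ
  have hφn : φ.Nonneg := nonneg_exp.subst hb hb0
  have hval : seriesValue (φ ^ N) (ENNReal.ofReal u) =
      ENNReal.ofReal (Real.exp (∑' k, coeff k b * u ^ k) ^ N) := by
    rw [seriesValue_pow hφn, hφ, seriesValue_subst nonneg_exp hb hb0,
      seriesValue_eq_ofReal_tsum hb hu hs, seriesValue_exp
        (tsum_nonneg fun k => mul_nonneg (hb k) (by positivity)),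
      ENNReal.ofReal_pow (Real.exp_nonneg _)]
  have hle := ENNReal.le_tsum (f := fun m => ENNReal.ofReal (coeff m (φ ^ N)) *
    ENNReal.ofReal u ^ m) n
  change _ ≤ seriesValue (φ ^ N) (ENNReal.ofReal u) at hle
  rwa [hval, ← ENNReal.ofReal_pow hu, ← ENNReal.ofReal_mul (hφn.pow N n),
    ENNReal.ofReal_le_ofReal_iff (by positivity)] at hle

theorem constantCoeff_exp_subst (hb0 : constantCoeff b = 0) :
    constantCoeff ((exp ℝ).subst b : ℝ⟦X⟧) = 1 := by
  rw [← coeff_zero_eq_constantCoeff_apply, coeff_subst_eq_sum _ hb0]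
  simp [coeff_exp]

/-- Suppose $ub'(u)<1$ on the whole disc of $b$, and choose $u$ with $y(\rho)<u<\eta$. Lagrange
inversion shows $x=ue^{-b(u)}\le\rho$, so $v=y(x)<u$ solves $v=xe^{b(v)}$. Then
$\log(u/v)=b(u)-b(v)\le ub'(u)\log(u/v)<\log(u/v)$, a contradiction. -/
theorem exists_critical_point (hb : b.Nonneg) (hb0 : constantCoeff b = 0)
    (hy : y.Nonneg) (hy0 : constantCoeff y = 0)
    (heq : y = X * subst y (subst b (exp ℝ) : ℝ⟦X⟧)) (hsub : SubcriticalPair y b) :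
    ∃ τ : ℝ, 0 < τ ∧ ENNReal.ofReal τ < seriesRadius b ∧
      ∑' k : ℕ, (k : ℝ) * (coeff k b * τ ^ k) = 1 := by
  by_contra hno
  have hlt1 : ∀ u : ℝ, 0 < u → ENNReal.ofReal u < seriesRadius b →
      ∑' k : ℕ, (k : ℝ) * (coeff k b * u ^ k) < 1 := by
    -- A value at least 1 would yield a critical point by the intermediate value theorem, as the sum
    -- vanishes at 0.
    intro u hu hur
    by_contra hge
    have hs1 : Summable fun n : ℕ => (n : ℝ) * (coeff n b * u ^ n) := by
      simpa using summable_pow_mul_coeff_of_lt_seriesRadius hb hu.le hur 1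
    have h0 : ∑' n : ℕ, (n : ℝ) * (coeff n b * (0 : ℝ) ^ n) = 0 := by
      rw [← tsum_zero (β := ℕ)]
      refine tsum_congr fun n => ?_
      rcases n with _ | n <;> simp
    obtain ⟨τ, hτ, hτ1⟩ := intermediate_value_Icc hu.le (continuousOn_tsum_coeff hb hs1)
      (show (1 : ℝ) ∈ _ from ⟨by rw [h0]; exact zero_le_one, not_lt.mp hge⟩)
    refine hno ⟨τ, lt_of_le_of_ne hτ.1 ?_, (ENNReal.ofReal_le_ofReal hτ.2).trans_lt hur, hτ1⟩
    rintro rfl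
    simp only at hτ1
    rw [h0] at hτ1
    exact zero_ne_one hτ1
  set φ : ℝ⟦X⟧ := (exp ℝ).subst b with hφ
  have hφn : φ.Nonneg := nonneg_exp.subst hb hb0
  unfold SubcriticalPair at hsub
  set ρ := seriesRadius y
  obtain ⟨U, hvU, hU⟩ := ENNReal.lt_iff_exists_nnreal_btwn.mp hsub
  set u : ℝ := (U : ℝ) with hu
  have hUu : (U : ℝ≥0∞) = ENNReal.ofReal u := by rw [hu]; simp
  rw [hUu] at hvU hU
  have hu0 : 0 < u := by
    rw [← ENNReal.ofReal_pos]; exact bot_le.trans_lt hvU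
  have hs := summable_of_lt_seriesRadius hb hu0.le hU
  have hs1 : Summable fun n : ℕ => (n : ℝ) * (coeff n b * u ^ n) := by
    simpa using summable_pow_mul_coeff_of_lt_seriesRadius hb hu0.le hU 1
  set s := ∑' n, coeff n b * u ^ n with hsdef
  set x : ℝ := u * Real.exp (-s) with hx
  have hx0 : 0 < x := by positivity
  -- The terms $y_nx^n$ stay below $u$: the factor $e^{b(u)}$ in the bound on $[u^n]\varphi^{n+1}$
  -- is cancelled by the $e^{-b(u)}$ in $x$.
  have hxρ : ENNReal.ofReal x ≤ ρ := by
    refine ofReal_le_seriesRadius hy (C := u) hx0.le fun n => ?_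
    rcases n with _ | n
    · simp [hy0, hu0.le]
    · have h1 := lagrange_inversion (by rw [hφ, constantCoeff_exp_subst hb0]; exact one_ne_zero)
        hy0 heq n
      have h2 := coeff_exp_subst_pow_mul_le hb hb0 hu0.le hs n (n + 1)
      rw [← hφ, ← h1, ← hsdef] at h2
      have h3 : coeff (n + 1) y ≤ ((n : ℝ) + 1) * coeff (n + 1) y := by
        have := hy (n + 1)
        nlinarith [n.cast_nonneg (α := ℝ)]
      have h5 : Real.exp s ^ (n + 1) * Real.exp (-s) ^ (n + 1) = 1 := by
        rw [← mul_pow, ← Real.exp_add, add_neg_cancel, Real.exp_zero, one_pow]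
      calc coeff (n + 1) y * x ^ (n + 1)
          = (coeff (n + 1) y * u ^ n) * (u * Real.exp (-s) ^ (n + 1)) := by rw [hx, mul_pow]; ring
        _ ≤ (((n : ℝ) + 1) * coeff (n + 1) y * u ^ n) * (u * Real.exp (-s) ^ (n + 1)) := by gcongr
        _ ≤ (Real.exp s ^ (n + 1)) * (u * Real.exp (-s) ^ (n + 1)) := by gcongr
        _ = u := by linear_combination u * h5
  have hyx : seriesValue y (ENNReal.ofReal x) < ENNReal.ofReal u :=
    (seriesValue_mono y hxρ).trans_lt hvU
  set v : ℝ := (seriesValue y (ENNReal.ofReal x)).toReal with hv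
  have hyv : seriesValue y (ENNReal.ofReal x) = ENNReal.ofReal v :=
    (ENNReal.ofReal_toReal hyx.ne_top).symm
  have hvu : v < u := by
    rw [hyv] at hyx
    exact (ENNReal.ofReal_lt_ofReal_iff hu0).mp hyx
  have hv0' : 0 ≤ v := ENNReal.toReal_nonneg
  have hsv := summable_of_lt_seriesRadius hb hv0'
    ((ENNReal.ofReal_le_ofReal hvu.le).trans_lt hU)
  have hveq : v = x * Real.exp (∑' n, coeff n b * v ^ n) := by
    have h1 : seriesValue y (ENNReal.ofReal x) =
        ENNReal.ofReal x * ENNReal.ofReal (Real.exp (∑' n, coeff n b * v ^ n)) := by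
      conv_lhs => rw [heq]
      rw [seriesValue_mul nonneg_X (hφn.subst hy hy0), seriesValue_X, seriesValue_subst hφn hy hy0,
        hyv, hφ, seriesValue_subst nonneg_exp hb hb0, seriesValue_eq_ofReal_tsum hb hv0' hsv,
        seriesValue_exp (tsum_nonneg fun n => mul_nonneg (hb n) (by positivity))]
    rw [hyv, ← ENNReal.ofReal_mul hx0.le] at h1
    exact (ENNReal.ofReal_eq_ofReal_iff hv0' (by positivity)).mp h1
  have hv0 : 0 < v := by rw [hveq]; positivity
  have hlog : Real.log (u / v) = s - ∑' n, coeff n b * v ^ n := by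
    rw [Real.log_div hu0.ne' hv0.ne']
    nth_rewrite 1 [hveq]
    rw [hx, Real.log_mul (by positivity) (by positivity), Real.log_mul (by positivity)
      (by positivity), Real.log_exp, Real.log_exp]
    ring
  have hL : 0 < Real.log (u / v) := Real.log_pos ((one_lt_div hv0).mpr hvu)
  have hle := tsum_coeff_sub_le hb hv0 hvu.le hs hs1
  rw [← hlog] at hle
  nlinarith [hlt1 u hu0 hU]

/-- The square-root type asymptotics of the coefficients of the solution of `y = z exp(b(y))` in the
subcritical case. -/
theorem exists_asymptotics_of_subcritical (hb : b.Nonneg) (hb0 : constantCoeff b = 0)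
    (hb1 : 1 ≤ coeff 1 b) (hy : y.Nonneg) (hy0 : constantCoeff y = 0)
    (heq : y = X * subst y (subst b (exp ℝ) : ℝ⟦X⟧)) (hsub : SubcriticalPair y b) :
    ∃ c γ : ℝ, 0 < c ∧ Real.exp 1 ≤ γ ∧ ENNReal.ofReal γ = (seriesRadius y)⁻¹ ∧
      (Summable fun n : ℕ => coeff n y * γ⁻¹ ^ n) ∧
      Tendsto (fun n : ℕ => √(n : ℝ) * n * (coeff n y * γ⁻¹ ^ n)) atTop (𝓝 c) := by
  obtain ⟨τ, hτ, hτr, hcrit⟩ := exists_critical_point hb hb0 hy hy0 heq hsub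
  have hs := summable_of_lt_seriesRadius hb hτ.le hτr
  have hs1 : Summable fun n : ℕ => (n : ℝ) * (coeff n b * τ ^ n) := by
    simpa using summable_pow_mul_coeff_of_lt_seriesRadius hb hτ.le hτr 1
  have hs2 := summable_pow_mul_coeff_of_lt_seriesRadius hb hτ.le hτr 2
  obtain ⟨c, hc, hlim⟩ := exists_tendsto_coeff_exp_subst_pow hb hb0 (by linarith) hτ hs hs2
    (by rw [← hcrit]; exact hs1.hasSum)
  set s := ∑' k, coeff k b * τ ^ k with hsdef
  set γ : ℝ := Real.exp s / τ with hγ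
  have hγ0 : 0 < γ := by positivity
  -- The linear coefficient of $b$ is at least 1, so $b(\tau)\ge\tau$; then $e\tau\le e^\tau$.
  have hγe : Real.exp 1 ≤ γ := by
    have h1 : τ ≤ s := by
      have := hs.sum_le_tsum {1} fun k _ => mul_nonneg (hb k) (by positivity)
      simp only [Finset.sum_singleton, pow_one] at this
      nlinarith
    rw [hγ, le_div_iff₀ hτ]
    calc Real.exp 1 * τ ≤ Real.exp 1 * Real.exp (τ - 1) := by
          gcongr; linarith [Real.add_one_le_exp (τ - 1)]
      _ = Real.exp τ := by rw [← Real.exp_add]; ring_nf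
      _ ≤ Real.exp s := Real.exp_le_exp.mpr h1
  have hlim2 : Tendsto (fun n : ℕ => √(n : ℝ) * n * (coeff n y * γ⁻¹ ^ n)) atTop (𝓝 (c * τ)) := by
    rw [← tendsto_add_atTop_iff_nat 1]
    -- Lagrange inversion pairs $y_{n+1}$ with $[u^n]\varphi^{n+1}$; the extra power of
    -- $\gamma^{-1}$ leaves one factor $\tau$ in the constant.
    refine (hlim.mul_const τ).congr fun n => ?_
    rw [← lagrange_inversion (by rw [constantCoeff_exp_subst hb0]; exact one_ne_zero) hy0 heq n,
      hγ, inv_div, div_pow]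
    push_cast
    field_simp
    ring
  have hrad : seriesRadius y = ENNReal.ofReal γ⁻¹ := by
    refine le_antisymm ?_ ?_
    · by_contra hlt
      rw [not_le] at hlt
      -- With a larger radius $n^2y_n\gamma^{-n}$ would tend to 0, yet it dominates
      -- $n^{3/2}y_n\gamma^{-n}$, whose limit is positive.
      have h2 := (summable_pow_mul_coeff_of_lt_seriesRadius hy (by positivity) hlt 2).tendsto_atTop_zero
      have h3 : c * τ ≤ 0 := by
        refine le_of_tendsto_of_tendsto' hlim2 h2 fun n => ?_
        have h4 : 0 ≤ coeff n y * γ⁻¹ ^ n := mul_nonneg (hy n) (by positivity)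
        have h5 : √(n : ℝ) * n ≤ (n : ℝ) ^ 2 := by
          rw [sq]
          gcongr
          rcases n with _ | n
          · simp
          · rw [Real.sqrt_le_left (by positivity)]
            push_cast
            nlinarith [n.cast_nonneg (α := ℝ)]
        exact mul_le_mul_of_nonneg_right h5 h4
      nlinarith
    · obtain ⟨C, hC⟩ := hlim2.bddAbove_range
      refine ofReal_le_seriesRadius hy (C := max C 0) (by positivity) fun n => ?_
      rcases n with _ | n
      · simp [hy0]
      · refine le_trans ?_ (le_max_left _ _)
        refine le_trans ?_ (hC ⟨n + 1, rfl⟩)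
        have h4 : 0 ≤ coeff (n + 1) y * γ⁻¹ ^ (n + 1) := mul_nonneg (hy _) (by positivity)
        have h1 : 1 ≤ √((n + 1 : ℕ) : ℝ) * ((n + 1 : ℕ) : ℝ) := by
          have h2 : (1 : ℝ) ≤ ((n + 1 : ℕ) : ℝ) := by push_cast; linarith [n.cast_nonneg (α := ℝ)]
          have h3 : 1 ≤ √((n + 1 : ℕ) : ℝ) := Real.one_le_sqrt.mpr h2
          nlinarith
        exact le_mul_of_one_le_left h4 h1
  refine ⟨c * τ, γ, by positivity, hγe, ?_, ?_, hlim2⟩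
  · rw [hrad, ENNReal.ofReal_inv_of_pos hγ0, inv_inv]
  · refine summable_of_seriesValue_ne_top hy (by positivity) ?_
    rw [← hrad]
    -- Subcriticality bounds $y(\rho)$ by a radius, so it is finite at the boundary point itself.
    exact (lt_of_lt_of_le hsub le_top).ne

end PowerSeries

/-! ### Transfer of asymptotics through an exponential -/

section ExpTransfer

variable {a g : ℕ → ℝ}

theorem sum_antidiagonal_mul_le (ha : ∀ n, 0 ≤ a n) (hg : ∀ n, 0 ≤ g n) {K : ℝ}
    (hK : ∀ n, a n ≤ K) (hgs : Summable g) (n : ℕ) :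
    ∑ p ∈ Finset.HasAntidiagonal.antidiagonal n, a p.1 * g p.2 ≤ K * ∑' n, g n := by
  have hK0 : 0 ≤ K := (ha 0).trans (hK 0)
  calc ∑ p ∈ Finset.HasAntidiagonal.antidiagonal n, a p.1 * g p.2
      ≤ ∑ p ∈ Finset.HasAntidiagonal.antidiagonal n, K * g p.2 :=
        Finset.sum_le_sum fun p _ => mul_le_mul_of_nonneg_right (hK _) (hg _)
    _ = K * ∑ j ∈ Finset.range (n + 1), g j := by
        rw [← Finset.mul_sum, ← Finset.Nat.sum_antidiagonal_eq_sum_range_succ_mk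
          (fun p => g p.1), ← Finset.Nat.sum_antidiagonal_swap]
        rfl
    _ ≤ K * ∑' n, g n := by
        gcongr
        exact hgs.sum_le_tsum _ fun n _ => hg n

/-- The recurrence is applied twice. It first bounds $ng_n$; then, writing the extra factor $n$ as
the sum of the two indices, it expresses $n^2g_n$ as a convolution of $(ia_i)$ with $g$ plus one of
$(ig_i)$ with $a$, each a bounded sequence against a summable one. -/
theorem exists_sq_mul_le (ha : ∀ n, 0 ≤ a n) (hg : ∀ n, 0 ≤ g n) (has : Summable a)
    (hgs : Summable g) (hrec : ∀ n : ℕ, (n : ℝ) * g n =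
      ∑ p ∈ Finset.HasAntidiagonal.antidiagonal n, a p.1 * g p.2) {K : ℝ}
    (hK : ∀ n : ℕ, (n : ℝ) * a n ≤ K) : ∃ M, ∀ n : ℕ, (n : ℝ) ^ 2 * g n ≤ M := by
  have h1 : ∀ n : ℕ, (n : ℝ) * g n ≤ (∑' n, a n) * ∑' n, g n := fun n => by
    rw [hrec]
    exact sum_antidiagonal_mul_le ha hg (fun n => has.le_tsum n fun m _ => ha m) hgs n
  refine ⟨K * (∑' n, g n) + ((∑' n, a n) * ∑' n, g n) * ∑' n, a n, fun n => ?_⟩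
  have h2 : (n : ℝ) ^ 2 * g n =
      (∑ p ∈ Finset.HasAntidiagonal.antidiagonal n, ((p.1 : ℝ) * a p.1) * g p.2) +
      ∑ p ∈ Finset.HasAntidiagonal.antidiagonal n, ((p.1 : ℝ) * g p.1) * a p.2 := by
    rw [← Finset.Nat.sum_antidiagonal_swap (f := fun p : ℕ × ℕ => ((p.1 : ℝ) * g p.1) * a p.2),
      ← Finset.sum_add_distrib, sq, mul_assoc, hrec, Finset.mul_sum]
    refine Finset.sum_congr rfl fun p hp => ?_
    rw [← Finset.HasAntidiagonal.mem_antidiagonal.mp hp]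
    simp only [Prod.fst_swap, Prod.snd_swap]
    push_cast; ring
  rw [h2]
  exact add_le_add
    (sum_antidiagonal_mul_le (fun n => mul_nonneg n.cast_nonneg (ha n)) hg hK hgs n)
    (sum_antidiagonal_mul_le (fun n => mul_nonneg n.cast_nonneg (hg n)) ha h1 has n)

theorem tendsto_sqrt_mul_shift {c : ℝ}
    (hlim : Tendsto (fun n : ℕ => √(n : ℝ) * n * a n) atTop (𝓝 c)) (j : ℕ) :
    Tendsto (fun n : ℕ => √(n : ℝ) * n * a (n - j)) atTop (𝓝 c) := by
  rw [← tendsto_add_atTop_iff_nat j]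
  have hq : Tendsto (fun m : ℕ => ((m : ℝ) + j) / m) atTop (𝓝 1) := by
    have h := (tendsto_const_div_atTop_nhds_zero_nat (j : ℝ)).const_add 1
    rw [add_zero] at h
    refine h.congr' ?_
    filter_upwards [eventually_gt_atTop 0] with m hm
    have : (m : ℝ) ≠ 0 := by exact_mod_cast hm.ne'
    field_simp
  have hq2 : Tendsto (fun m : ℕ => √(((m : ℝ) + j) / m)) atTop (𝓝 1) := by
    have := (Real.continuous_sqrt.tendsto 1).comp hq
    rwa [Real.sqrt_one] at this
  have h := (hlim.mul hq).mul hq2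
  rw [mul_one, mul_one] at h
  refine h.congr' ?_
  filter_upwards [eventually_gt_atTop 0] with m hm
  have hm' : (0 : ℝ) < m := by exact_mod_cast hm
  have : 0 < √(m : ℝ) := Real.sqrt_pos.mpr hm'
  rw [Nat.add_sub_cancel, Real.sqrt_div' _ hm'.le]
  push_cast
  field_simp

/-- If `n gₙ = ∑ aₖ gₙ₋ₖ` with `aₙ ∼ c n^{-3/2}` then `gₙ ∼ c (∑ g) n^{-5/2}`. -/
theorem tendsto_of_exp_recurrence (ha : ∀ n, 0 ≤ a n) (hg : ∀ n, 0 ≤ g n) (has : Summable a)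
    (hgs : Summable g) (hrec : ∀ n : ℕ, (n : ℝ) * g n =
      ∑ p ∈ Finset.HasAntidiagonal.antidiagonal n, a p.1 * g p.2) {c : ℝ}
    (hlim : Tendsto (fun n : ℕ => √(n : ℝ) * n * a n) atTop (𝓝 c)) :
    Tendsto (fun n : ℕ => √(n : ℝ) * n ^ 2 * g n) atTop (𝓝 (c * ∑' n, g n)) := by
  obtain ⟨K, hK⟩ := hlim.bddAbove_range
  have hK' : ∀ n : ℕ, √(n : ℝ) * n * a n ≤ K := fun n => hK ⟨n, rfl⟩
  have hK0 : 0 ≤ K := by simpa using hK' 0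
  have hKn : ∀ n : ℕ, (n : ℝ) * a n ≤ K := by
    intro n
    rcases n with _ | n
    · simpa using hK0
    · refine le_trans ?_ (hK' (n + 1))
      have h1 : 1 ≤ √((n + 1 : ℕ) : ℝ) :=
        Real.one_le_sqrt.mpr (by push_cast; linarith [n.cast_nonneg (α := ℝ)])
      rw [mul_assoc]
      exact le_mul_of_one_le_left (mul_nonneg (by positivity) (ha _)) h1
  obtain ⟨M, hM⟩ := exists_sq_mul_le ha hg has hgs hrec hKn
  have hM0 : 0 ≤ M := by simpa using hM 0
  -- The part of the convolution with $j\le n/2$. There $n\le 2(n-j)$, so $n^{3/2}a_{n-j}\le 4K$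
  -- uniformly and dominated convergence applies.
  set f : ℕ → ℕ → ℝ := fun n j => if 2 * j ≤ n then √(n : ℝ) * n * a (n - j) * g j else 0 with hf
  have hT1 : Tendsto (fun n => ∑' j, f n j) atTop (𝓝 (∑' j, c * g j)) := by
    refine tendsto_tsum_of_dominated_convergence (bound := fun j => 4 * K * g j)
      (hgs.mul_left _) (fun j => ?_) (Eventually.of_forall fun n j => ?_)
    · refine ((tendsto_sqrt_mul_shift hlim j).mul_const (g j)).congr' ?_
      filter_upwards [eventually_ge_atTop (2 * j)] with n hn
      simp [hf, hn]
    · by_cases h : 2 * j ≤ n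
      · simp only [hf, if_pos h]
        rw [Real.norm_of_nonneg (mul_nonneg (mul_nonneg (by positivity) (ha _)) (hg _))]
        refine mul_le_mul_of_nonneg_right ?_ (hg j)
        set m := n - j
        have hnm : (n : ℝ) ≤ 4 * m := by
          have : n ≤ 4 * m := by omega
          exact_mod_cast this
        have hnm2 : (n : ℝ) ≤ 2 * m := by
          have : n ≤ 2 * m := by omega
          exact_mod_cast this
        have hsq : √(n : ℝ) ≤ 2 * √(m : ℝ) := by
          have h4 : (2 : ℝ) * √(m : ℝ) = √(4 * m) := by
            rw [Real.sqrt_mul (by norm_num)]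
            congr 1
            rw [show (4 : ℝ) = 2 ^ 2 by norm_num, Real.sqrt_sq (by norm_num)]
          rw [h4]; exact Real.sqrt_le_sqrt hnm
        have := ha m
        calc √(n : ℝ) * n * a m ≤ (2 * √(m : ℝ)) * (2 * m) * a m := by gcongr
          _ = 4 * (√(m : ℝ) * m * a m) := by ring
          _ ≤ 4 * K := by linarith [hK' m]
      · simp only [hf, if_neg h, norm_zero]
        exact mul_nonneg (by positivity) (hg j)
  -- For $j>n/2$ the bound $n^2g_j\le 4M$ leaves $4Mn^{-1/2}\sum a$, which vanishes in the limit.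
  have hT2 : Tendsto (fun n : ℕ => √(n : ℝ) * n ^ 2 * g n - ∑' j, f n j) atTop (𝓝 0) := by
    have hsqrt : Tendsto (fun n : ℕ => √(n : ℝ)) atTop atTop :=
      Real.tendsto_sqrt_atTop.comp tendsto_natCast_atTop_atTop
    have hb : Tendsto (fun n : ℕ => 4 * M * (∑' n, a n) / √(n : ℝ)) atTop (𝓝 0) :=
      hsqrt.const_div_atTop _
    have hdiff : ∀ n : ℕ, √(n : ℝ) * n ^ 2 * g n - ∑' j, f n j =
        ∑ p ∈ Finset.HasAntidiagonal.antidiagonal n,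
          if 2 * p.2 ≤ n then 0 else √(n : ℝ) * n * a p.1 * g p.2 := by
      intro n
      have h1 : ∑' j, f n j = ∑ p ∈ Finset.HasAntidiagonal.antidiagonal n, f n p.2 := by
        rw [tsum_eq_sum (s := Finset.range (n + 1)),
          ← Finset.Nat.sum_antidiagonal_eq_sum_range_succ_mk (fun p => f n p.1),
          ← Finset.Nat.sum_antidiagonal_swap]
        · rfl
        · intro j hj
          have : ¬ 2 * j ≤ n := by
            simp only [Finset.mem_range] at hj; omega
          simp [hf, this]
      have h2 : √(n : ℝ) * n ^ 2 * g n = ∑ p ∈ Finset.HasAntidiagonal.antidiagonal n,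
          √(n : ℝ) * n * a p.1 * g p.2 := by
        calc √(n : ℝ) * n ^ 2 * g n = √(n : ℝ) * n * (n * g n) := by ring
          _ = _ := by
            rw [hrec, Finset.mul_sum]
            exact Finset.sum_congr rfl fun p _ => by ring
      rw [h1, h2, ← Finset.sum_sub_distrib]
      refine Finset.sum_congr rfl fun p hp => ?_
      have hp1 : p.1 = n - p.2 := by
        have := Finset.HasAntidiagonal.mem_antidiagonal.mp hp; omega
      by_cases h : 2 * p.2 ≤ n
      · simp only [hf, if_pos h, hp1, sub_self]
      · simp only [hf, if_neg h, sub_zero]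
    simp_rw [hdiff]
    refine squeeze_zero' (Eventually.of_forall fun n => Finset.sum_nonneg fun p _ => ?_) ?_ hb
    · split_ifs
      · exact le_rfl
      · exact mul_nonneg (mul_nonneg (by positivity) (ha _)) (hg _)
    · filter_upwards [eventually_gt_atTop 0] with n hn
      have hn0 : (0 : ℝ) < n := by exact_mod_cast hn
      have hr : 0 < √(n : ℝ) := Real.sqrt_pos.mpr hn0
      have hrr : √(n : ℝ) * √(n : ℝ) = n := Real.mul_self_sqrt hn0.le
      calc ∑ p ∈ Finset.HasAntidiagonal.antidiagonal n,
            (if 2 * p.2 ≤ n then 0 else √(n : ℝ) * n * a p.1 * g p.2)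
          ≤ ∑ p ∈ Finset.HasAntidiagonal.antidiagonal n, 4 * M / √(n : ℝ) * a p.1 := by
            refine Finset.sum_le_sum fun p _ => ?_
            have hap := ha p.1
            split_ifs with h
            · positivity
            · have h1 : (n : ℝ) ≤ 2 * p.2 := by
                have : n ≤ 2 * p.2 := by omega
                exact_mod_cast this
              have h2 : (n : ℝ) ^ 2 * g p.2 ≤ 4 * M := by
                have h3 : (n : ℝ) ^ 2 ≤ (2 * p.2) ^ 2 := by gcongr
                have := hM p.2
                nlinarith [hg p.2]
              have h4 : √(n : ℝ) * n * a p.1 * g p.2 = ((n : ℝ) ^ 2 * g p.2) / √(n : ℝ) * a p.1 := by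
                rw [eq_comm, div_mul_eq_mul_div, div_eq_iff hr.ne']
                linear_combination (-(n * a p.1 * g p.2)) * hrr
              rw [h4]
              gcongr
        _ = 4 * M / √(n : ℝ) * ∑ j ∈ Finset.range (n + 1), a j := by
            rw [← Finset.mul_sum,
              ← Finset.Nat.sum_antidiagonal_eq_sum_range_succ_mk (fun p => a p.1)]
        _ ≤ 4 * M / √(n : ℝ) * ∑' n, a n := by
            gcongr
            exact has.sum_le_tsum _ fun n _ => ha n
        _ = 4 * M * (∑' n, a n) / √(n : ℝ) := by ring
  have h := hT1.add hT2
  rw [add_zero, tsum_mul_left] at h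
  exact h.congr fun n => by ring

theorem isEquivalent_of_tendsto_sqrt_mul_sq {f : ℕ → ℝ} {γ c : ℝ} (hγ : 0 < γ) (hc : 0 < c)
    (h : Tendsto (fun n : ℕ => √(n : ℝ) * n ^ 2 * (f n * γ⁻¹ ^ n)) atTop (𝓝 c)) :
    Asymptotics.IsEquivalent atTop f fun n : ℕ => c * (n : ℝ) ^ (-(5 / 2) : ℝ) * γ ^ n := by
  refine Asymptotics.isEquivalent_of_tendsto_one ?_
  have h1 := h.div_const c
  rw [div_self hc.ne'] at h1
  refine h1.congr' ?_
  filter_upwards [eventually_gt_atTop 0] with n hn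
  have hn0 : (0 : ℝ) < n := by exact_mod_cast hn
  have h2 : (n : ℝ) ^ (-(5 / 2) : ℝ) = (√(n : ℝ) * n ^ 2)⁻¹ := by
    rw [Real.rpow_neg hn0.le, show (5 / 2 : ℝ) = 1 / 2 + (2 : ℕ) by norm_num, Real.rpow_add hn0,
      Real.rpow_natCast, Real.sqrt_eq_rpow]
  have hr : 0 < √(n : ℝ) := Real.sqrt_pos.mpr hn0
  rw [Pi.div_apply, h2, inv_pow]
  field_simp

end ExpTransfer

end Asymptotics

/-! ### Connections inside a vertex set -/

namespace SimpleGraph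

variable {V : Type*} {G : SimpleGraph V} {S T U : Set V} {a b c : V}

/-- `u` and `v` are adjacent and both lie in `S`. -/
def StepIn (G : SimpleGraph V) (S : Set V) (u v : V) : Prop := G.Adj u v ∧ u ∈ S ∧ v ∈ S

/-- There is a walk from `u` to `v` all of whose steps are inside `S`. -/
def ConnIn (G : SimpleGraph V) (S : Set V) : V → V → Prop := Relation.ReflTransGen (G.StepIn S)

theorem ConnIn.refl (a : V) : G.ConnIn S a a := Relation.ReflTransGen.refl

theorem StepIn.symm (h : G.StepIn S a b) : G.StepIn S b a := ⟨h.1.symm, h.2.2, h.2.1⟩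

theorem ConnIn.symm (h : G.ConnIn S a b) : G.ConnIn S b a :=
  haveI : Std.Symm (G.StepIn S) := ⟨fun _ _ => StepIn.symm⟩
  Std.Symm.symm (r := Relation.ReflTransGen (G.StepIn S)) _ _ h

theorem ConnIn.trans (h : G.ConnIn S a b) (h' : G.ConnIn S b c) : G.ConnIn S a c :=
  Relation.ReflTransGen.trans h h'

theorem ConnIn.tail (h : G.ConnIn S a b) (h' : G.StepIn S b c) : G.ConnIn S a c :=
  Relation.ReflTransGen.tail h h'

theorem ConnIn.mono (hST : S ⊆ T) (h : G.ConnIn S a b) : G.ConnIn T a b :=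
  Relation.ReflTransGen.mono (r := G.StepIn S) (p := G.StepIn T)
    (fun _ _ h => ⟨h.1, hST h.2.1, hST h.2.2⟩) _ _ h

/-- The standard invariance argument: it serves both to bound a component from outside and to
confine a walk to a smaller set. -/
theorem ConnIn.of_closed (h : G.ConnIn S a b) (ha : a ∈ U)
    (hU : ∀ u ∈ U, ∀ w, G.StepIn S u w → w ∈ U) : G.ConnIn U a b ∧ b ∈ U := by
  induction h with
  | refl => exact ⟨ConnIn.refl a, ha⟩
  | tail _ hs ih =>
    have hw := hU _ ih.2 _ hs
    exact ⟨ih.1.tail ⟨hs.1, ih.2, hw⟩, hw⟩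

theorem ConnIn.mem (h : G.ConnIn S a b) (ha : a ∈ S) : b ∈ S :=
  (h.of_closed ha fun _ _ _ hs => hs.2.2).2

/-- A walk can be pushed forward along a map that sends adjacent vertices to equal or adjacent
vertices. -/
theorem ConnIn.image {f : V → V} (hf : ∀ u v, G.Adj u v → f u = f v ∨ G.Adj (f u) (f v))
    (h : G.ConnIn S a b) : G.ConnIn (f '' S) (f a) (f b) := by
  induction h with
  | refl => exact ConnIn.refl _
  | tail _ hs ih =>
    rcases hf _ _ hs.1 with h | h
    · rwa [← h]
    · exact ih.tail ⟨h, Set.mem_image_of_mem f hs.2.1, Set.mem_image_of_mem f hs.2.2⟩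

theorem induce_connected_iff : (G.induce S).Connected ↔
    S.Nonempty ∧ ∀ u ∈ S, ∀ v ∈ S, G.ConnIn S u v := by
  constructor
  · intro h
    have h1 := h.preconnected
    have h2 := h.nonempty
    refine ⟨Set.nonempty_coe_sort.mp h2, fun u hu v hv => ?_⟩
    obtain ⟨w⟩ := h1 ⟨u, hu⟩ ⟨v, hv⟩
    have : ∀ {x y : S}, (G.induce S).Walk x y → G.ConnIn S x y := by
      intro x y w
      induction w with
      | nil => exact ConnIn.refl _
      | cons h _ ih => exact Relation.ReflTransGen.head ⟨h, Subtype.prop _, Subtype.prop _⟩ ih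
    exact this w
  · rintro ⟨h1, h2⟩
    have := h1.to_subtype
    refine ⟨fun u v => ?_⟩
    have : ∀ {y : V}, G.ConnIn S u y → ∀ hy : y ∈ S, (G.induce S).Reachable u ⟨y, hy⟩ := by
      intro y h
      induction h with
      | refl => exact fun _ => Reachable.refl _
      | tail _ hs ih =>
        intro hy
        exact (ih hs.2.1).trans (Adj.reachable (G := G.induce S) hs.1)
    exact this (h2 u u.2 v v.2) v.2

theorem induce_connected_of_forall {r : V} (hr : r ∈ S) (h : ∀ v ∈ S, G.ConnIn S r v) :
    (G.induce S).Connected :=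
  induce_connected_iff.mpr ⟨⟨r, hr⟩, fun u hu v hv => (h u hu).symm.trans (h v hv)⟩

theorem connected_iff_connIn_univ : G.Connected ↔
    Nonempty V ∧ ∀ u v, G.ConnIn Set.univ u v := by
  rw [← (induceUnivIso G).connected_iff, induce_connected_iff, ← Set.nonempty_iff_univ_nonempty]
  simp

/-- Inducing twice is inducing once. -/
noncomputable def induceInduceIso (G : SimpleGraph V) (A : Set V) (X : Set A) :
    (G.induce A).induce X ≃g G.induce (Subtype.val '' X) where
  toEquiv := Equiv.Set.image Subtype.val X Subtype.val_injective
  map_rel_iff' := by intro a b; exact Iff.rfl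

/-- The induced subgraphs on equal sets are isomorphic. -/
def induceCongrIso (G : SimpleGraph V) (h : S = T) : G.induce S ≃g G.induce T where
  toEquiv := Equiv.setCongr h
  map_rel_iff' := by intro a b; exact Iff.rfl

/-- An isomorphism restricts to induced subgraphs on the image. -/
noncomputable def Iso.induceImage {W : Type*} {H : SimpleGraph W} (e : G ≃g H) (X : Set V) :
    G.induce X ≃g H.induce (e '' X) :=
  e.induce (e.injective.injOn.bijOn_image)

theorem induce_induce_compl_singleton_connected_iff (v : S) :
    ((G.induce S).induce {v}ᶜ).Connected ↔ (G.induce (S \ {(v : V)})).Connected := by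
  rw [(induceInduceIso G S {v}ᶜ).connected_iff, (induceCongrIso G (T := S \ {(v : V)}) ?_).connected_iff]
  ext x
  constructor
  · rintro ⟨y, hy, rfl⟩
    exact ⟨y.2, fun h => hy (Subtype.ext h)⟩
  · rintro ⟨hx, hxv⟩
    exact ⟨⟨x, hx⟩, fun h => hxv (congrArg Subtype.val h), rfl⟩

/-- The deleted vertex may range over all of `V`, as deleting one outside `S` changes nothing; this
avoids subtypes later on. -/
theorem induce_isTwoConnected_iff : (G.induce S).IsTwoConnected ↔
    S.Nontrivial ∧ (G.induce S).Connected ∧ ∀ v, (G.induce (S \ {v})).Connected := by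
  constructor
  · rintro ⟨h1, h2, h3⟩
    refine ⟨Set.nontrivial_coe_sort.mp h1, h2, fun v => ?_⟩
    by_cases hv : v ∈ S
    · exact (induce_induce_compl_singleton_connected_iff ⟨v, hv⟩).mp (h3 ⟨v, hv⟩)
    · rwa [Set.sdiff_singleton_eq_self hv]
  · rintro ⟨h1, h2, h3⟩
    exact ⟨Set.nontrivial_coe_sort.mpr h1, h2, fun v =>
      (induce_induce_compl_singleton_connected_iff v).mpr (h3 v)⟩

end SimpleGraph

namespace SimpleGraph

variable {V : Type*} {G : SimpleGraph V} {ι : Type*} {A : ι → Set V}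

/-! ### Graphs glued from pieces -/

/-- Every edge lies inside one of the vertex sets `A i`. -/
def GluedAlong (G : SimpleGraph V) (A : ι → Set V) : Prop :=
  ∀ u v, G.Adj u v → ∃ i, u ∈ A i ∧ v ∈ A i

/-- If the pieces pairwise share at most one vertex, then a graph all of whose edges lie in pieces
is the same as a family of graphs on the pieces. -/
def gluedEquiv (hA : ∀ i j, i ≠ j → (A i ∩ A j).Subsingleton) :
    {G : SimpleGraph V // G.GluedAlong A} ≃ ((i : ι) → SimpleGraph (A i)) where
  toFun G i := G.1.induce (A i)
  invFun H := ⟨{ Adj := fun u v => ∃ (i : ι) (hu : u ∈ A i) (hv : v ∈ A i), (H i).Adj ⟨u, hu⟩ ⟨v, hv⟩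
                 symm := ⟨fun _ _ ⟨i, hu, hv, h⟩ => ⟨i, hv, hu, h.symm⟩⟩
                 loopless := ⟨fun _ ⟨i, _, _, h⟩ => (H i).irrefl h⟩ },
    fun _ _ ⟨i, hu, hv, _⟩ => ⟨i, hu, hv⟩⟩
  left_inv G := by
    ext u v
    constructor
    · rintro ⟨i, hu, hv, h⟩; exact h
    · intro h
      obtain ⟨i, hu, hv⟩ := G.2 u v h
      exact ⟨i, hu, hv, h⟩
  right_inv H := by
    funext i
    ext u v
    constructor
    · rintro ⟨j, hu, hv, h⟩
      -- An edge has two distinct ends, so it lies in at most one piece.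
      obtain rfl : i = j := by
        by_contra hij
        exact h.ne (Subtype.ext (hA i j hij ⟨u.2, hu⟩ ⟨v.2, hv⟩))
      exact h
    · intro h
      exact ⟨i, u.2, v.2, h⟩

theorem induce_image_isTwoConnected_iff {B : Set V} (X : Set B) :
    (G.induce (Subtype.val '' X)).IsTwoConnected ↔ ((G.induce B).induce X).IsTwoConnected :=
  ⟨fun h => h.of_iso (induceInduceIso G B X).symm, fun h => h.of_iso (induceInduceIso G B X)⟩

/-- A 2-connected set has at least two vertices and so lies in exactly one piece; a larger
2-connected set lies in the same one, which makes maximality a local matter. -/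
theorem isBlock_induce_iff (hA : ∀ i j, i ≠ j → (A i ∩ A j).Subsingleton)
    (hT : ∀ T, (G.induce T).IsTwoConnected → ∃ i, T ⊆ A i) (i : ι) (S : Set (A i)) :
    (G.induce (A i)).IsBlock S ↔ G.IsBlock (Subtype.val '' S) := by
  constructor
  · rintro ⟨h1, h2⟩
    refine ⟨(induce_image_isTwoConnected_iff S).mpr h1, fun T hT2 hST => ?_⟩
    obtain ⟨j, hj⟩ := hT T hT2
    obtain ⟨x, hx, y, hy, hxy⟩ := (induce_isTwoConnected_iff.mp h1).1
    obtain rfl : i = j := by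
      by_contra hij
      exact hxy (Subtype.ext (hA i j hij ⟨x.2, hj (hST ⟨x, hx, rfl⟩)⟩ ⟨y.2, hj (hST ⟨y, hy, rfl⟩)⟩))
    have hT' : Subtype.val '' (Subtype.val ⁻¹' T : Set (A i)) = T := by
      rw [Subtype.image_preimage_coe, Set.inter_eq_right]; exact hj
    have h3 : (Subtype.val ⁻¹' T : Set (A i)) ⊆ S := by
      refine h2 ((induce_image_isTwoConnected_iff _).mp ?_) fun x hx => hST ⟨x, hx, rfl⟩
      rwa [hT']
    rw [← hT']
    exact Set.image_mono h3
  · rintro ⟨h1, h2⟩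
    refine ⟨(induce_image_isTwoConnected_iff S).mp h1, fun T hT2 hST => ?_⟩
    have := h2 ((induce_image_isTwoConnected_iff T).mpr hT2) (Set.image_mono hST)
    intro x hx
    obtain ⟨y, hy, hyx⟩ := this ⟨x, hx, rfl⟩
    rwa [← Subtype.ext hyx]

theorem IsBlock.image {W : Type*} {H : SimpleGraph W} (e : G ≃g H) {S : Set V} (h : G.IsBlock S) :
    H.IsBlock (e '' S) := by
  refine ⟨h.1.of_iso (e.induceImage S), fun T hT hST => ?_⟩
  have h1 : (G.induce (e.symm '' T)).IsTwoConnected := hT.of_iso (e.symm.induceImage T)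
  have h2 := h.2 h1 fun x hx => ⟨e x, hST ⟨x, hx, rfl⟩, by simp⟩
  intro y hy
  exact ⟨e.symm y, h2 ⟨y, hy, rfl⟩, by simp⟩

end SimpleGraph

/-! ### Block-stable classes on arbitrary finite vertex sets, and gluing. -/

namespace LabelledGraphClass

variable {𝒢 : LabelledGraphClass} {V W : Type} {G : SimpleGraph V} {H : SimpleGraph W}

theorem Contains.of_iso (e : G ≃g H) (h : 𝒢.Contains G) : 𝒢.Contains H := by
  obtain ⟨n, K, hK, ⟨f⟩⟩ := h
  exact ⟨n, K, hK, ⟨e.symm.trans f⟩⟩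

theorem contains_iff_of_iso (e : G ≃g H) : 𝒢.Contains G ↔ 𝒢.Contains H :=
  ⟨Contains.of_iso e, Contains.of_iso e.symm⟩

theorem contains_iff_mem {n : ℕ} {G : SimpleGraph (Fin n)} : 𝒢.Contains G ↔ G ∈ 𝒢.graphs n := by
  constructor
  · rintro ⟨m, K, hK, ⟨f⟩⟩
    obtain rfl : n = m := by simpa using Fintype.card_congr f.toEquiv
    exact 𝒢.iso_mem ⟨f.symm⟩ hK
  · exact fun h => ⟨n, G, h, ⟨SimpleGraph.Iso.refl⟩⟩

theorem contains_connectedSubclass_iff :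
    𝒢.connectedSubclass.Contains G ↔ 𝒢.Contains G ∧ G.Connected := by
  constructor
  · rintro ⟨n, K, hK, ⟨f⟩⟩
    exact ⟨⟨n, K, hK.1, ⟨f⟩⟩, f.connected_iff.mpr hK.2⟩
  · rintro ⟨⟨n, K, hK, ⟨f⟩⟩, hG⟩
    exact ⟨n, K, ⟨hK, f.connected_iff.mp hG⟩, ⟨f⟩⟩

theorem contains_twoConnectedSubclass_iff :
    𝒢.twoConnectedSubclass.Contains G ↔ 𝒢.Contains G ∧ G.IsTwoConnected := by
  constructor
  · rintro ⟨n, K, hK, ⟨f⟩⟩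
    exact ⟨⟨n, K, hK.1, ⟨f⟩⟩, hK.2.of_iso f.symm⟩
  · rintro ⟨⟨n, K, hK, ⟨f⟩⟩, hG⟩
    exact ⟨n, K, ⟨hK, hG.of_iso f⟩, ⟨f⟩⟩

theorem BlockStable.contains_iff [Finite V] (h : 𝒢.BlockStable) :
    𝒢.Contains G ↔ ∀ S, G.IsBlock S → 𝒢.Contains (G.induce S) := by
  obtain ⟨n, ⟨e⟩⟩ := Finite.exists_equiv_fin V
  set K : SimpleGraph (Fin n) := G.map e.toEmbedding
  let f : G ≃g K := SimpleGraph.Iso.map e G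
  rw [contains_iff_of_iso f, contains_iff_mem, h.2]
  constructor
  · intro hK S hS
    exact (hK _ (hS.image f)).of_iso (f.induceImage S).symm
  · intro hG S hS
    exact (hG _ (hS.image f.symm)).of_iso (f.symm.induceImage S).symm

/-- Gluing graphs along single vertices does not leave a block-stable class. -/
theorem BlockStable.contains_iff_forall_induce [Finite V] (h : 𝒢.BlockStable) {ι : Type*}
    {A : ι → Set V} (hA : ∀ i j, i ≠ j → (A i ∩ A j).Subsingleton)
    (hT : ∀ T, (G.induce T).IsTwoConnected → ∃ i, T ⊆ A i) :
    𝒢.Contains G ↔ ∀ i, 𝒢.Contains (G.induce (A i)) := by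
  constructor
  · intro hG i
    rw [h.contains_iff]
    intro S hS
    exact (h.contains_iff.mp hG _ ((SimpleGraph.isBlock_induce_iff hA hT i S).mp hS)).of_iso
      (SimpleGraph.induceInduceIso G (A i) S).symm
  · intro hG
    rw [h.contains_iff]
    intro S hS
    obtain ⟨i, hi⟩ := hT S hS.1
    have hS' : Subtype.val '' (Subtype.val ⁻¹' S : Set (A i)) = S := by
      rw [Subtype.image_preimage_coe, Set.inter_eq_right]; exact hi
    have hb : (G.induce (A i)).IsBlock (Subtype.val ⁻¹' S) := by
      rw [SimpleGraph.isBlock_induce_iff hA hT, hS']; exact hS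
    refine (h.contains_iff.mp (hG i) _ hb).of_iso ((SimpleGraph.induceInduceIso G (A i) _).trans ?_)
    exact SimpleGraph.induceCongrIso G hS'

/-- The number of members of the class on the vertex set `Fin n`. -/
noncomputable def count (𝒢 : LabelledGraphClass) (n : ℕ) : ℕ := (𝒢.graphs n).ncard

theorem card_contains [Finite V] (𝒢 : LabelledGraphClass) :
    Nat.card {G : SimpleGraph V // 𝒢.Contains G} = 𝒢.count (Nat.card V) := by
  have e := Finite.equivFin V
  rw [count, ← Nat.card_coe_set_eq]
  refine Nat.card_congr (e.simpleGraph.subtypeEquiv fun G => ?_)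
  rw [← contains_iff_mem]
  exact contains_iff_of_iso (SimpleGraph.Iso.comap e.symm G).symm

end LabelledGraphClass

/-! ### Walks avoiding one or two vertices. -/

namespace SimpleGraph

variable {V : Type*} {G : SimpleGraph V} {S T U : Set V} {r x x' a z : V}

theorem subset_of_induce_connected (h : (G.induce T).Connected) (hx : x ∈ T) (hxU : x ∈ U)
    (hU : ∀ u ∈ U, ∀ w, G.StepIn T u w → w ∈ U) : T ⊆ U := fun y hy =>
  (((induce_connected_iff.mp h).2 x hx y hy).of_closed hxU hU).2

/-- A vertex set that can only be left through `r` stays connected to `r` when `r` is added. -/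
theorem ConnIn.insert_of_closed (hU : ∀ u ∈ U, ∀ w, G.Adj u w → w ≠ r → w ∈ U) (ha : a ∈ U)
    (h : G.ConnIn S a r) : G.ConnIn (insert r U) a r := by
  have key : ∀ w, G.ConnIn S a w → (G.ConnIn (insert r U) a w ∧ w ∈ U) ∨ G.ConnIn (insert r U) a r := by
    intro w hw
    induction hw with
    | refl => exact Or.inl ⟨ConnIn.refl a, ha⟩
    | @tail b c _ hs ih =>
      rcases ih with ⟨h1, h2⟩ | h1
      · by_cases hc : c = r
        · subst hc
          exact Or.inr (h1.tail ⟨hs.1, Set.mem_insert_of_mem _ h2, Set.mem_insert _ _⟩)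
        · have hcU := hU b h2 c hs.1 hc
          exact Or.inl ⟨h1.tail ⟨hs.1, Set.mem_insert_of_mem _ h2, Set.mem_insert_of_mem _ hcU⟩, hcU⟩
      · exact Or.inr h1
  rcases key r h with h | h
  · exact h.1
  · exact h

/-- Whichever of $x,x'$ the walk met first would be reached while avoiding the other, which is
excluded. -/
theorem ConnIn.compl_pair (hne : x ≠ x') (haz : G.ConnIn S a z) (hax : a ≠ x) (hax' : a ≠ x')
    (h : ¬ G.ConnIn {x'}ᶜ a x) (h' : ¬ G.ConnIn {x}ᶜ a x') : G.ConnIn ({x, x'}ᶜ) a z := by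
  have ha : a ∈ ({x, x'}ᶜ : Set V) := by simp [hax, hax']
  induction haz with
  | refl => exact ConnIn.refl a
  | @tail b c _ hs ih =>
    have hb : b ∈ ({x, x'}ᶜ : Set V) := ih.mem ha
    have hbx : b ≠ x := fun h => hb (by simp [h])
    have hbx' : b ≠ x' := fun h => hb (by simp [h])
    have hsub : ({x, x'}ᶜ : Set V) ⊆ {x}ᶜ := by
      intro y hy hyx; exact hy (by rw [Set.mem_singleton_iff.mp hyx]; simp)
    have hsub' : ({x, x'}ᶜ : Set V) ⊆ {x'}ᶜ := by
      intro y hy hyx; exact hy (by rw [Set.mem_singleton_iff.mp hyx]; simp)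
    by_cases hcx : c = x
    · subst hcx
      exact absurd ((ih.mono hsub').tail ⟨hs.1, hbx', hne⟩) h
    · by_cases hcx' : c = x'
      · subst hcx'
        exact absurd ((ih.mono hsub).tail ⟨hs.1, hbx, hcx⟩) h'
      · exact ih.tail ⟨hs.1, hb, by simp [hcx, hcx']⟩

/-! ### The vertices dominated by a vertex -/

/-- The vertices that cannot be reached from `r` without meeting `x`. -/
def dominated (G : SimpleGraph V) (r x : V) : Set V := {v | ¬ G.ConnIn {x}ᶜ r v}

theorem self_mem_dominated (hx : x ≠ r) : x ∈ G.dominated r x := fun h =>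
  h.mem (S := {x}ᶜ) (show r ∈ ({x}ᶜ : Set V) from fun h => hx h.symm) rfl

theorem root_notMem_dominated : r ∉ G.dominated r x := fun h => h (ConnIn.refl r)

theorem mem_dominated_of_adj {u w : V} (hu : u ∈ G.dominated r x) (hux : u ≠ x)
    (huw : G.Adj u w) (hwx : w ≠ x) : w ∈ G.dominated r x := fun h =>
  hu (h.tail ⟨huw.symm, hwx, hux⟩)

/-- A walk from $r$ avoiding $x'$ never meets $x$. Together with the next two lemmas this says that
the dominated sets form a laminar family, as for the dominator tree of a rooted graph. -/
theorem dominated_subset (h : x ∈ G.dominated r x') :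
    G.dominated r x ⊆ G.dominated r x' := by
  intro w hw hcon
  have key : ∀ w, G.ConnIn {x'}ᶜ r w → G.ConnIn {x}ᶜ r w := by
    intro w hw
    induction hw with
    | refl => exact ConnIn.refl r
    | @tail b c hb hs ih =>
      have hbx : b ≠ x := fun hbx => h (hbx ▸ hb)
      have hcx : c ≠ x := fun hcx => h (hcx ▸ hb.tail hs)
      exact ih.tail ⟨hs.1, hbx, hcx⟩
  exact hw (key w hcon)

theorem notMem_dominated_of_mem (hG : G.Connected) (hx : x ≠ r) (hx' : x' ≠ r) (hne : x ≠ x')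
    (h : x ∈ G.dominated r x') : x' ∉ G.dominated r x := by
  intro h'
  have := ConnIn.compl_pair hne ((connected_iff_connIn_univ.mp hG).2 r x) hx.symm hx'.symm h h'
  exact this.mem (S := {x, x'}ᶜ) (by simp [hx.symm, hx'.symm]) (by simp)

theorem disjoint_dominated (hG : G.Connected) (hne : x ≠ x')
    (h : x ∉ G.dominated r x') (h' : x' ∉ G.dominated r x) :
    Disjoint (G.dominated r x) (G.dominated r x') := by
  rw [Set.disjoint_left]
  intro v hv hv'
  have hvx : v ≠ x := fun e => h (e ▸ hv')
  have hvx' : v ≠ x' := fun e => h' (e ▸ hv)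
  have h1 : G.ConnIn {x'}ᶜ r x := not_not.mp h
  have h2 : G.ConnIn {x}ᶜ r x' := not_not.mp h'
  have h3 := ConnIn.compl_pair hne ((connected_iff_connIn_univ.mp hG).2 v r) hvx hvx'
    (fun hc => hv' (h1.trans hc.symm)) (fun hc => hv (h2.trans hc.symm))
  refine hv ((h3.mono ?_).symm)
  intro y hy hyx; exact hy (by rw [Set.mem_singleton_iff.mp hyx]; simp)

/-- The vertices other than `r` that are dominated only by themselves. -/
def dominationRoots (G : SimpleGraph V) (r : V) : Set V :=
  {s | s ≠ r ∧ ∀ x, x ≠ r → x ≠ s → s ∉ G.dominated r x}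

/-- Take a dominator of $v$ whose dominated set is maximal; anything dominating it would have a
strictly larger set. -/
theorem exists_mem_dominationRoots [Finite V] (hG : G.Connected) {v : V} (hv : v ≠ r) :
    ∃ s ∈ G.dominationRoots r, v ∈ G.dominated r s := by
  obtain ⟨s, ⟨hs1, hs2⟩, hs3⟩ := Set.Finite.exists_maximalFor (fun x => G.dominated r x)
    {x | x ≠ r ∧ v ∈ G.dominated r x} (Set.toFinite _) ⟨v, hv, self_mem_dominated hv⟩
  refine ⟨s, ⟨hs1, fun x hx hxs hsx => ?_⟩, hs2⟩
  have hsub := dominated_subset hsx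
  have := hs3 ⟨hx, hsub hs2⟩ hsub (self_mem_dominated hx)
  exact notMem_dominated_of_mem hG hs1 hx hxs.symm hsx this

theorem eq_of_mem_dominated (hG : G.Connected) {s s' v : V} (hs : s ∈ G.dominationRoots r)
    (hs' : s' ∈ G.dominationRoots r) (h : v ∈ G.dominated r s) (h' : v ∈ G.dominated r s') :
    s = s' := by
  by_contra hne
  exact Set.disjoint_left.mp (disjoint_dominated hG hne (hs.2 s' hs'.1 (Ne.symm hne))
    (hs'.2 s hs.1 hne)) h h'

/-! ### The block at a root that is not a cut vertex, and the graphs hanging from it -/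

/-- `f` maps every vertex to the vertex of the block at `r` from which it hangs. -/
structure IsBlockRetraction (G : SimpleGraph V) (r : V) (f : V → V) : Prop where
  idem : ∀ v, f (f v) = f v
  eq_root_iff : ∀ v, f v = r ↔ v = r
  adj : ∀ u v, G.Adj u v → (f u = u ∧ f v = v) ∨ f u = f v
  block : (G.induce {v | f v = v}).IsTwoConnected
  fiber : ∀ s, f s = s → s ≠ r → (G.induce {v | f v = s}).Connected

namespace IsBlockRetraction

variable {f f' : V → V}

theorem map_root (h : G.IsBlockRetraction r f) : f r = r := (h.eq_root_iff r).mpr rfl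

theorem connIn_fiber (h : G.IsBlockRetraction r f) (v : V) : G.ConnIn {w | f w = f v} v (f v) := by
  by_cases hv : v = r
  · rw [(h.eq_root_iff v).mpr hv, hv]; exact ConnIn.refl r
  · exact (induce_connected_iff.mp (h.fiber (f v) (h.idem v)
      fun e => hv ((h.eq_root_iff v).mp e))).2 v rfl (f v) (h.idem v)

theorem connIn_fixed (h : G.IsBlockRetraction r f) {u v : V} (hu : f u = u) (hv : f v = v) (x : V)
    (hux : u ≠ x) (hvx : v ≠ x) : G.ConnIn ({w | f w = w} \ {x}) u v :=
  (induce_connected_iff.mp ((induce_isTwoConnected_iff.mp h.block).2.2 x)).2 u ⟨hu, hux⟩ v ⟨hv, hvx⟩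

/-- The fibre of a fixed point $s$ can be left only through $s$, while any other vertex is reached
through the block, which stays connected without $s$. Fibres, and with `fixed_iff` also the fixed
points, are thus determined by `G` alone, whence uniqueness. -/
theorem mem_dominated_iff (h : G.IsBlockRetraction r f) {s v : V} (hs : f s = s) (hsr : s ≠ r) :
    v ∈ G.dominated r s ↔ f v = s := by
  constructor
  · intro hv
    by_contra hne
    refine hv (ConnIn.trans (b := f v) ?_ ?_)
    · exact (h.connIn_fixed h.map_root (h.idem v) s hsr.symm hne).mono fun y hy => hy.2
    · refine (h.connIn_fiber v).symm.mono fun y hy hys => hne ?_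
      rw [← hy, Set.mem_singleton_iff.mp hys, hs]
  · intro hv hcon
    have := (hcon.of_closed (U := {w | f w ≠ s}) (by
      show f r ≠ s
      rw [h.map_root]; exact hsr.symm) fun u hu w hw => ?_).2
    · exact this hv
    · intro hfw
      rcases h.adj u w hw.1 with ⟨-, h2⟩ | h2
      · exact hw.2.2 (h2.symm.trans hfw)
      · exact hu (h2.trans hfw)

theorem fixed_iff (h : G.IsBlockRetraction r f) {s : V} (hsr : s ≠ r) :
    f s = s ↔ s ∈ G.dominationRoots r := by
  constructor
  · intro hs
    refine ⟨hsr, fun x hx hxs hsx => ?_⟩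
    by_cases hfx : f x = x
    · exact hxs (((h.mem_dominated_iff hfx hx).mp hsx).symm.trans hs)
    · exact hsx ((h.connIn_fixed h.map_root hs x hx.symm hxs.symm).mono fun y hy => hy.2)
  · intro hs
    by_contra hne
    have hr : f s ≠ r := fun e => hsr ((h.eq_root_iff s).mp e)
    exact hs.2 (f s) hr hne ((h.mem_dominated_iff (h.idem s) hr).mpr rfl)

theorem unique (h : G.IsBlockRetraction r f) (h' : G.IsBlockRetraction r f') : f = f' := by
  funext v
  by_cases hv : v = r
  · rw [hv, h.map_root, h'.map_root]
  · have hr : f v ≠ r := fun e => hv ((h.eq_root_iff v).mp e)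
    have h1 : f' (f v) = f v := (h'.fixed_iff hr).mpr ((h.fixed_iff hr).mp (h.idem v))
    exact ((h'.mem_dominated_iff h1 hr).mp ((h.mem_dominated_iff (h.idem v) hr).mpr rfl)).symm

theorem connected (h : G.IsBlockRetraction r f) : G.Connected := by
  have h1 := (induce_connected_iff.mp (induce_isTwoConnected_iff.mp h.block).2.1).2
  rw [connected_iff_connIn_univ]
  refine ⟨⟨r⟩, fun u v => ?_⟩
  exact (((h.connIn_fiber u).mono (Set.subset_univ _)).trans
    ((h1 _ (h.idem u) _ (h.idem v)).mono (Set.subset_univ _))).trans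
    ((h.connIn_fiber v).symm.mono (Set.subset_univ _))

theorem induce_compl_connected (h : G.IsBlockRetraction r f) : (G.induce {r}ᶜ).Connected := by
  obtain ⟨⟨x, hx⟩, -⟩ := induce_connected_iff.mp ((induce_isTwoConnected_iff.mp h.block).2.2 r)
  have hfib : ∀ v, v ≠ r → {w | f w = f v} ⊆ ({r}ᶜ : Set V) := by
    intro v hv w hw hwr
    rw [Set.mem_singleton_iff.mp hwr, Set.mem_ofPred_eq, h.map_root] at hw
    exact hv ((h.eq_root_iff v).mp hw.symm)
  rw [induce_connected_iff]
  refine ⟨⟨x, hx.2⟩, fun u hu v hv => ?_⟩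
  have hu' : f u ≠ r := fun e => hu ((h.eq_root_iff u).mp e)
  have hv' : f v ≠ r := fun e => hv ((h.eq_root_iff v).mp e)
  exact (((h.connIn_fiber u).mono (hfib u hu)).trans
    ((h.connIn_fixed (h.idem u) (h.idem v) r hu' hv').mono fun y hy => hy.2)).trans
    ((h.connIn_fiber v).symm.mono (hfib v hv))

/-- If $T$ contains a non-fixed vertex $v$, then $T$ without $f(v)$ is still connected, and $f(v)$
was the only exit from the fibre of $v$. -/
theorem subset_of_isTwoConnected (h : G.IsBlockRetraction r f)
    (hT : (G.induce T).IsTwoConnected) :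
    T ⊆ {v | f v = v} ∨ ∃ s, f s = s ∧ s ≠ r ∧ T ⊆ {v | f v = s} := by
  by_cases hfix : T ⊆ {v | f v = v}
  · exact Or.inl hfix
  · obtain ⟨v, hvT, hv⟩ := Set.not_subset.mp hfix
    have hvr : f v ≠ r := fun e => hv (by
      show f v = v
      rw [e, (h.eq_root_iff v).mp e])
    refine Or.inr ⟨f v, h.idem v, hvr, ?_⟩
    have h1 : T \ {f v} ⊆ {w | f w = f v} := by
      refine subset_of_induce_connected ((induce_isTwoConnected_iff.mp hT).2.2 (f v)) (x := v)
        ⟨hvT, fun e => hv (Set.mem_singleton_iff.mp e).symm⟩ rfl fun u hu w hw => ?_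
      rcases h.adj u w hw.1 with ⟨h2, -⟩ | h2
      · exact absurd (h2.symm.trans hu) hw.2.1.2
      · exact h2.symm.trans hu
    intro w hw
    by_cases hwv : w = f v
    · rw [hwv]; exact h.idem v
    · exact h1 ⟨hw, hwv⟩

end IsBlockRetraction

/-- The retraction sends $v\ne r$ to the unique domination root dominating it. Applying it to a walk
gives a walk in the fixed set, so connectivity of the block is inherited from that of `G`, and, when
$r$ is deleted, from that of `G` without $r$. -/
theorem exists_isBlockRetraction [Finite V] (hG : G.Connected)
    (hGr : (G.induce {r}ᶜ).Connected) : ∃ f, G.IsBlockRetraction r f := by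
  classical
  have huniv := (connected_iff_connIn_univ.mp hG).2
  choose! g hg hgd using fun v (hv : v ≠ r) => exists_mem_dominationRoots hG hv
  set f : V → V := fun v => if v = r then r else g v with hf
  have hfr : f r = r := by simp [hf]
  have hfv : ∀ v, v ≠ r → f v = g v := fun v hv => by simp [hf, hv]
  have hfeq : ∀ s ∈ G.dominationRoots r, ∀ v, v ∈ G.dominated r s ↔ f v = s := by
    intro s hs v
    constructor
    · intro hv
      have hvr : v ≠ r := fun e => root_notMem_dominated (e ▸ hv)
      rw [hfv v hvr]
      exact eq_of_mem_dominated hG (hg v hvr) hs (hgd v hvr) hv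
    · rintro rfl
      by_cases hvr : v = r
      · rw [hvr, hfr] at hs; exact absurd rfl hs.1
      · rw [hfv v hvr]; exact hgd v hvr
  have hfS : ∀ s ∈ G.dominationRoots r, f s = s := fun s hs =>
    (hfeq s hs s).mp (self_mem_dominated hs.1)
  have hmem : ∀ v, v ≠ r → f v ∈ G.dominationRoots r := fun v hv => by rw [hfv v hv]; exact hg v hv
  have hroot : ∀ v, f v = r ↔ v = r := fun v =>
    ⟨fun h => by_contra fun hv => (hmem v hv).1 h, fun h => by rw [h, hfr]⟩
  have hidem : ∀ v, f (f v) = f v := fun v => by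
    by_cases hv : v = r
    · rw [hv, hfr, hfr]
    · exact hfS _ (hmem v hv)
  have hfix : ∀ u v, G.Adj u v → f u ≠ f v → f u = u := by
    intro u v huv hne
    by_cases hu : u = r
    · rw [hu, hfr]
    · by_contra hfu
      have hud := (hfeq _ (hmem u hu) u).mpr rfl
      have hvs : v ≠ f u := fun e => hne (by rw [e, hidem])
      exact hne ((hfeq _ (hmem u hu) v).mp (mem_dominated_of_adj hud (Ne.symm hfu) huv hvs)).symm
  have hadj : ∀ u v, G.Adj u v → (f u = u ∧ f v = v) ∨ f u = f v := by
    intro u v huv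
    by_cases hne : f u = f v
    · exact Or.inr hne
    · exact Or.inl ⟨hfix u v huv hne, hfix v u huv.symm (Ne.symm hne)⟩
  have hproj : ∀ u v, G.Adj u v → f u = f v ∨ G.Adj (f u) (f v) := by
    intro u v huv
    rcases hadj u v huv with ⟨h1, h2⟩ | h
    · rw [h1, h2]; exact Or.inr huv
    · exact Or.inl h
  have himage : ∀ S : Set V, ∀ u v, f u = u → f v = v → G.ConnIn S u v →
      G.ConnIn (f '' S) u v := by
    intro S u v hu hv h
    have := h.image hproj
    rwa [hu, hv] at this
  obtain ⟨⟨y, hy⟩, hGr'⟩ := induce_connected_iff.mp hGr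
  refine ⟨f, hidem, hroot, hadj, ?_, ?_⟩
  · rw [induce_isTwoConnected_iff]
    refine ⟨⟨r, hfr, f y, hidem y, fun e => hy ((hroot y).mp e.symm)⟩, ?_, fun x => ?_⟩
    · refine induce_connected_of_forall hfr fun v hv => ?_
      refine (himage _ r v hfr hv (huniv r v)).mono ?_
      rintro _ ⟨w, -, rfl⟩
      exact hidem w
    · by_cases hxr : x = r
      · subst hxr
        rw [induce_connected_iff]
        refine ⟨⟨f y, hidem y, fun e => hy ((hroot y).mp e)⟩, fun u hu v hv => ?_⟩
        refine (himage _ u v hu.1 hv.1 (hGr' u hu.2 v hv.2)).mono ?_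
        rintro _ ⟨w, hw, rfl⟩
        exact ⟨hidem w, fun e => hw ((hroot w).mp e)⟩
      · refine induce_connected_of_forall (r := r) ⟨hfr, fun e => hxr e.symm⟩ fun v hv => ?_
        by_cases hx : x ∈ G.dominationRoots r
        · have h1 : v ∉ G.dominated r x := fun h => hv.2 (hv.1.symm.trans ((hfeq x hx v).mp h))
          have h2 : G.ConnIn {x}ᶜ r v := not_not.mp h1
          -- A walk from $r$ avoiding $x$ avoids everything dominated by $x$, that is the whole
          -- fibre over $x$, so its image misses $x$.
          have h3 : G.ConnIn (G.dominated r x)ᶜ r v := by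
            refine (h2.of_closed (U := (G.dominated r x)ᶜ) root_notMem_dominated
              fun u hu w hw => ?_).1
            exact fun hwd => hu (mem_dominated_of_adj hwd hw.2.2 hw.1.symm hw.2.1)
          refine (himage _ r v hfr hv.1 h3).mono ?_
          rintro _ ⟨w, hw, rfl⟩
          exact ⟨hidem w, fun e => hw ((hfeq x hx w).mpr e)⟩
        · have hfx : f x ≠ x := fun e => hx (e ▸ hmem x hxr)
          refine (himage _ r v hfr hv.1 (huniv r v)).mono ?_
          rintro _ ⟨w, -, rfl⟩
          refine ⟨hidem w, fun e => hfx ?_⟩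
          rw [← Set.mem_singleton_iff.mp e, hidem]
  · intro s hs hsr
    have hsS : s ∈ G.dominationRoots r := hs ▸ hmem s hsr
    refine induce_connected_of_forall (r := s) hs fun v hv => ?_
    by_cases hvs : v = s
    · rw [hvs]; exact ConnIn.refl s
    · have h := ConnIn.insert_of_closed (U := G.dominated r s \ {s}) (r := s)
        (fun u hu w huw hws => ⟨mem_dominated_of_adj hu.1 hu.2 huw hws, hws⟩)
        (⟨(hfeq s hsS v).mpr hv, hvs⟩ : v ∈ G.dominated r s \ {s}) (huniv v s)
      refine h.symm.mono ?_
      rintro w (rfl | hw)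
      · exact hs
      · exact (hfeq s hsS w).mp hw.1

end SimpleGraph

/-! ### Counting graphs through their decompositions into pieces. -/

theorem Nat.card_subtype_eq_sum {X T : Type*} [Finite X] [Fintype T] {Q : X → Prop}
    {R : T → X → Prop} (h : ∀ x, Q x → ∃! t, R t x) (h' : ∀ t x, R t x → Q x) :
    Nat.card {x // Q x} = ∑ t, Nat.card {x // R t x} := by
  rw [← Nat.card_sigma]
  symm
  refine Nat.card_congr (Equiv.ofBijective (fun p : Σ t, {x // R t x} => ⟨p.2.1, h' p.1 _ p.2.2⟩) ⟨?_, ?_⟩)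
  · rintro ⟨t, x, hx⟩ ⟨t', x', hx'⟩ heq
    obtain rfl : x = x' := congrArg Subtype.val heq
    obtain rfl : t = t' := (h x (h' t x hx)).unique hx hx'
    rfl
  · rintro ⟨x, hx⟩
    obtain ⟨t, ht, -⟩ := h x hx
    exact ⟨⟨t, x, ht⟩, rfl⟩

namespace SimpleGraph

theorem card_glued {V : Type*} {ι : Type*} [Fintype ι] {A : ι → Set V}
    (hA : ∀ i j, i ≠ j → (A i ∩ A j).Subsingleton) (P : ∀ i, SimpleGraph (A i) → Prop) :
    Nat.card {G : SimpleGraph V // G.GluedAlong A ∧ ∀ i, P i (G.induce (A i))} =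
      ∏ i, Nat.card {H : SimpleGraph (A i) // P i H} := by
  rw [← Nat.card_pi]
  refine Nat.card_congr ?_
  refine (Equiv.subtypeSubtypeEquivSubtypeInter (fun G : SimpleGraph V => G.GluedAlong A)
    (fun G => ∀ i, P i (G.induce (A i)))).symm.trans ?_
  refine Equiv.trans ?_ (Equiv.subtypePiEquivPi (p := fun i (H : SimpleGraph (A i)) => P i H))
  exact (gluedEquiv hA).subtypeEquiv fun G => Iff.rfl

theorem inter_cond_subsingleton {V : Type*} {S T : Set V} (h : (S ∩ T).Subsingleton) (i j : Bool)
    (hij : i ≠ j) : ((cond i S T) ∩ (cond j S T)).Subsingleton := by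
  cases i <;> cases j <;> simp_all [Set.inter_comm]

theorem subset_or_subset_compl {V : Type*} {G : SimpleGraph V} {B T : Set V}
    (hcl : ∀ u ∈ T, ∀ w ∈ T, G.Adj u w → u ∈ B → w ∈ B) (hT : (G.induce T).Connected) :
    T ⊆ B ∨ T ⊆ Bᶜ := by
  obtain ⟨⟨x, hx⟩, -⟩ := induce_connected_iff.mp hT
  by_cases hxB : x ∈ B
  · exact Or.inl (subset_of_induce_connected hT hx hxB fun u hu w hw =>
      hcl u hw.2.1 w hw.2.2 hw.1 hu)
  · exact Or.inr (subset_of_induce_connected hT hx hxB fun u hu w hw hwB =>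
      hu (hcl w hw.2.2 u hw.2.1 hw.1.symm hwB))

end SimpleGraph

namespace LabelledGraphClass

open SimpleGraph

variable {𝒢 : LabelledGraphClass} {V : Type}

/-- The graph belongs to the class, is connected, and stays connected if `r` is deleted. -/
def NonCutRooted (𝒢 : LabelledGraphClass) (r : V) (G : SimpleGraph V) : Prop :=
  𝒢.Contains G ∧ G.Connected ∧ (G.induce {r}ᶜ).Connected

/-- A graph is its component at `r` together with the rest. -/
theorem BlockStable.card_contains_eq_sum [Fintype V] [DecidableEq V] (h : 𝒢.BlockStable) (r : V) :
    Nat.card {G : SimpleGraph V // 𝒢.Contains G} = ∑ A : {A : Finset V // r ∉ A},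
      𝒢.connectedSubclass.count (A.1.card + 1) * 𝒢.count (Fintype.card V - (A.1.card + 1)) := by
  -- `A` is the component of `r` without `r`; `true` indexes that component and `false` the
  -- remaining vertices.
  set pc : {A : Finset V // r ∉ A} → Bool → Set V :=
    fun A i => cond i (insert r (A.1 : Set V)) (insert r (A.1 : Set V))ᶜ with hpc
  have hdis : ∀ A i j, i ≠ j → (pc A i ∩ pc A j).Subsingleton := fun A =>
    inter_cond_subsingleton (by simp)
  have hcl : ∀ A (G : SimpleGraph V), G.GluedAlong (pc A) → ∀ u w, G.Adj u w → u ∈ pc A true → w ∈ pc A true := by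
    intro A G hG u w huw hu
    obtain ⟨i, h1, h2⟩ := hG u w huw
    cases i
    · exact absurd hu h1
    · exact h2
  have hiff : ∀ A (G : SimpleGraph V), G.GluedAlong (pc A) →
      (𝒢.Contains G ↔ ∀ i, 𝒢.Contains (G.induce (pc A i))) := by
    intro A G hG
    refine h.contains_iff_forall_induce (hdis A) fun T hT => ?_
    rcases subset_or_subset_compl (B := pc A true) (fun u _ w _ => hcl A G hG u w)
      (induce_isTwoConnected_iff.mp hT).2.1 with h1 | h1
    · exact ⟨true, h1⟩
    · exact ⟨false, h1⟩
  rw [Nat.card_subtype_eq_sum (R := fun A G => G.GluedAlong (pc A) ∧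
    ∀ i, (cond i 𝒢.connectedSubclass 𝒢).Contains (G.induce (pc A i)))]
  · refine Finset.sum_congr rfl fun A _ => ?_
    rw [card_glued (hdis A) fun i H => (cond i 𝒢.connectedSubclass 𝒢).Contains H,
      Fintype.prod_bool, card_contains, card_contains]
    have h1 : Nat.card (pc A true) = A.1.card + 1 := by
      rw [Nat.card_coe_set_eq, hpc]
      simp only [cond_true]
      rw [Set.ncard_insert_of_notMem (by simpa using A.2), Set.ncard_coe_finset]
    have h2 : Nat.card (pc A false) = Fintype.card V - (A.1.card + 1) := by
      rw [← h1, Nat.card_coe_set_eq, Nat.card_coe_set_eq, ← Nat.card_eq_fintype_card,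
        ← Set.ncard_compl]
      rfl
    rw [h1, h2]
    rfl
  · intro G hG
    set B : Set V := {w | G.ConnIn Set.univ r w} with hB
    have hrB : r ∈ B := ConnIn.refl r
    have hAB : insert r (((Set.toFinite (B \ {r})).toFinset : Finset V) : Set V) = B := by
      rw [Set.Finite.coe_toFinset, Set.insert_sdiff_singleton, Set.insert_eq_of_mem hrB]
    refine ⟨⟨(Set.toFinite (B \ {r})).toFinset, by simp⟩, ?_, ?_⟩
    · have hBcl : ∀ u w, G.Adj u w → u ∈ B → w ∈ B := fun u w huw hu =>
        ConnIn.tail hu ⟨huw, Set.mem_univ _, Set.mem_univ _⟩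
      have hglue : G.GluedAlong (pc ⟨(Set.toFinite (B \ {r})).toFinset, by simp⟩) := by
        intro u w huw
        simp only [hpc, hAB]
        by_cases hu : u ∈ B
        · exact ⟨true, hu, hBcl u w huw hu⟩
        · exact ⟨false, hu, fun hw => hu (hBcl w u huw.symm hw)⟩
      refine ⟨hglue, fun i => ?_⟩
      have hc := (hiff _ G hglue).mp hG i
      cases i
      · exact hc
      · refine contains_connectedSubclass_iff.mpr ⟨hc, ?_⟩
        refine (induceCongrIso G hAB).connected_iff.mpr ?_
        exact induce_connected_of_forall hrB fun v hv =>
          (ConnIn.of_closed (U := B) hv hrB fun u hu w hw => hBcl u w hw.1 hu).1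
    · rintro A ⟨hglue, hA⟩
      have hconn := (contains_connectedSubclass_iff.mp (hA true)).2
      have hAB' : insert r (A.1 : Set V) = B := by
        ext w
        constructor
        · intro hw
          exact ((induce_connected_iff.mp hconn).2 r (Set.mem_insert _ _) w hw).mono
            (Set.subset_univ _)
        · intro hw
          exact (ConnIn.of_closed (U := insert r (A.1 : Set V)) hw (Set.mem_insert _ _)
            fun u hu w hw => hcl A G hglue u w hw.1 hu).2
      refine Subtype.ext (Finset.coe_injective ?_)
      rw [Set.Finite.coe_toFinset, ← hAB', Set.insert_sdiff_self_of_notMem (by simpa using A.2)]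
  · rintro A G ⟨hglue, hA⟩
    refine (hiff A G hglue).mpr fun i => ?_
    cases i
    · exact hA false
    · exact (contains_connectedSubclass_iff.mp (hA true)).1

/-- A connected graph is split at `r` into the part containing `v` and the rest. -/
theorem BlockStable.card_connected_eq_sum [Fintype V] [DecidableEq V] (h : 𝒢.BlockStable)
    {r v : V} (hrv : v ≠ r) {d : ℕ → ℕ} (hd : ∀ (W : Type) [Finite W] (r : W),
      Nat.card {G : SimpleGraph W // 𝒢.NonCutRooted r G} = d (Nat.card W - 1)) :
    Nat.card {G : SimpleGraph V // 𝒢.connectedSubclass.Contains G} =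
      ∑ A : {A : Finset V // r ∉ A ∧ v ∉ A},
        d (A.1.card + 1) * 𝒢.connectedSubclass.count (Fintype.card V - (A.1.card + 1)) := by
  -- `B A` is the component of `v` after deleting `r`. The piece `true` adds `r` to it, the piece
  -- `false` is its complement; they share only `r`. As `d` is indexed by the number of non-root
  -- vertices, it is evaluated at $|A|+1$.
  set B : {A : Finset V // r ∉ A ∧ v ∉ A} → Set V := fun A => insert v (A.1 : Set V) with hBdef
  have hrB : ∀ A, r ∉ B A := fun A => by simp [hBdef, hrv.symm, A.2.1]
  set pc : {A : Finset V // r ∉ A ∧ v ∉ A} → Bool → Set V :=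
    fun A i => cond i (insert r (B A)) (B A)ᶜ with hpc
  have hdis : ∀ A i j, i ≠ j → (pc A i ∩ pc A j).Subsingleton := fun A =>
    inter_cond_subsingleton (by
      rintro x ⟨hx1 | hx1, hx2⟩ y ⟨hy1 | hy1, hy2⟩
      · rw [hx1, hy1]
      · exact absurd hy1 hy2
      · exact absurd hx1 hx2
      · exact absurd hx1 hx2)
  have hcl : ∀ A (G : SimpleGraph V), G.GluedAlong (pc A) → ∀ u w, G.Adj u w → w ≠ r → u ∈ B A → w ∈ B A := by
    intro A G hG u w huw hwr hu
    obtain ⟨i, h1, h2⟩ := hG u w huw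
    cases i
    · exact absurd hu h1
    · exact h2.resolve_left hwr
  have hiff : ∀ A (G : SimpleGraph V), G.GluedAlong (pc A) →
      (𝒢.Contains G ↔ ∀ i, 𝒢.Contains (G.induce (pc A i))) := by
    intro A G hG
    refine h.contains_iff_forall_induce (hdis A) fun T hT => ?_
    rcases subset_or_subset_compl (B := B A) (fun u hu w hw huw => hcl A G hG u w huw hw.2)
      ((induce_isTwoConnected_iff.mp hT).2.2 r) with h1 | h1
    · refine ⟨true, fun x hx => ?_⟩
      by_cases hxr : x = r
      · exact Or.inl hxr
      · exact Or.inr (h1 ⟨hx, hxr⟩)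
    · refine ⟨false, fun x hx => ?_⟩
      by_cases hxr : x = r
      · rw [hxr]; exact hrB A
      · exact h1 ⟨hx, hxr⟩
  set P : ∀ A i, SimpleGraph (pc A i) → Prop := fun A i =>
    match i with
    | true => fun H => 𝒢.NonCutRooted (⟨r, Set.mem_insert _ _⟩ : pc A true) H
    | false => fun H => 𝒢.connectedSubclass.Contains H with hP
  have hdiff : ∀ A, pc A true \ {r} = B A := fun A =>
    Set.insert_sdiff_self_of_notMem (hrB A)
  have hPtrue : ∀ A (G : SimpleGraph V), P A true (G.induce (pc A true)) ↔
      𝒢.Contains (G.induce (pc A true)) ∧ (G.induce (pc A true)).Connected ∧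
        (G.induce (B A)).Connected := by
    intro A G
    simp only [hP, NonCutRooted]
    rw [induce_induce_compl_singleton_connected_iff, (induceCongrIso G (hdiff A)).connected_iff]
  rw [Nat.card_subtype_eq_sum (R := fun A G => G.GluedAlong (pc A) ∧
    ∀ i, P A i (G.induce (pc A i)))]
  · refine Finset.sum_congr rfl fun A _ => ?_
    rw [card_glued (hdis A) (P A), Fintype.prod_bool]
    have h0 : (B A).ncard = A.1.card + 1 := by
      rw [hBdef, Set.ncard_insert_of_notMem (by simpa using A.2.2), Set.ncard_coe_finset]
    have h1 : Nat.card (pc A true) = A.1.card + 2 := by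
      rw [Nat.card_coe_set_eq, hpc]
      simp only [cond_true]
      rw [Set.ncard_insert_of_notMem (hrB A), h0]
    have h2 : Nat.card (pc A false) = Fintype.card V - (A.1.card + 1) := by
      rw [← h0, Nat.card_coe_set_eq, ← Nat.card_eq_fintype_card, ← Set.ncard_compl]
      rfl
    have h3 := hd (pc A true) ⟨r, Set.mem_insert _ _⟩
    have h4 := card_contains (V := pc A false) 𝒢.connectedSubclass
    rw [h1] at h3
    rw [h2] at h4
    exact congrArg₂ _ h3 h4
  · intro G hG
    rw [contains_connectedSubclass_iff] at hG
    have huniv := (connected_iff_connIn_univ.mp hG.2).2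
    set B₀ : Set V := {w | G.ConnIn {r}ᶜ v w} with hB₀
    have hvB : v ∈ B₀ := ConnIn.refl v
    have hrB₀ : r ∉ B₀ := fun hr => hr.mem (S := {r}ᶜ) hrv rfl
    set A₀ : {A : Finset V // r ∉ A ∧ v ∉ A} :=
      ⟨(Set.toFinite (B₀ \ {v})).toFinset, by simp [hrB₀], by simp⟩ with hA₀
    have hAB : B A₀ = B₀ := by
      simp only [hBdef, hA₀]
      rw [Set.Finite.coe_toFinset, Set.insert_sdiff_singleton, Set.insert_eq_of_mem hvB]
    refine ⟨A₀, ?_, ?_⟩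
    · have hBcl : ∀ u ∈ B₀, ∀ w, G.Adj u w → w ≠ r → w ∈ B₀ := fun u hu w huw hw =>
        ConnIn.tail hu ⟨huw, fun e => hrB₀ (Set.mem_singleton_iff.mp e ▸ hu), hw⟩
      have hglue : G.GluedAlong (pc A₀) := by
        intro u w huw
        simp only [hpc, hAB]
        by_cases hu : u ∈ B₀
        · refine ⟨true, Or.inr hu, ?_⟩
          by_cases hw : w = r
          · exact Or.inl hw
          · exact Or.inr (hBcl u hu w huw hw)
        · by_cases hw : w ∈ B₀
          · refine ⟨true, ?_, Or.inr hw⟩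
            by_cases hur : u = r
            · exact Or.inl hur
            · exact absurd (hBcl w hw u huw.symm hur) hu
          · exact ⟨false, hu, hw⟩
      refine ⟨hglue, fun i => ?_⟩
      have hc := (hiff _ G hglue).mp hG.1 i
      cases i
      · refine contains_connectedSubclass_iff.mpr ⟨hc, ?_⟩
        refine (induceCongrIso G (congrArg compl hAB)).connected_iff.mpr ?_
        refine induce_connected_of_forall (r := r) hrB₀ fun w hw => ?_
        by_cases hwr : w = r
        · rw [hwr]; exact ConnIn.refl r
        · have := ConnIn.insert_of_closed (U := B₀ᶜ \ {r}) (r := r)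
            (fun u hu w huw hwr => ⟨fun hwB => hu.1 (hBcl w hwB u huw.symm hu.2), hwr⟩)
            (⟨hw, hwr⟩ : w ∈ B₀ᶜ \ {r}) (huniv w r)
          refine this.symm.mono ?_
          rintro y (rfl | hy)
          · exact hrB₀
          · exact hy.1
      · rw [hPtrue]
        refine ⟨hc, ?_, ?_⟩
        · refine (induceCongrIso G (congrArg (insert r) hAB)).connected_iff.mpr ?_
          exact induce_connected_of_forall (Set.mem_insert _ _) fun w hw => by
            by_cases hwr : w = r
            · rw [hwr]; exact ConnIn.refl r
            · exact (ConnIn.insert_of_closed hBcl (hw.resolve_left hwr) (huniv w r)).symm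
        · rw [hAB]
          exact induce_connected_of_forall hvB fun w hw =>
            (ConnIn.of_closed (U := B₀) hw hvB fun u hu w hw => hBcl u hu w hw.1 hw.2.2).1
    · rintro A ⟨hglue, hA⟩
      have hconn := ((hPtrue A G).mp (hA true)).2.2
      have hAB' : B A = B₀ := by
        ext w
        constructor
        · intro hw
          exact ((induce_connected_iff.mp hconn).2 v (Set.mem_insert _ _) w hw).mono
            fun y hy e => hrB A (Set.mem_singleton_iff.mp e ▸ hy)
        · intro hw
          exact (ConnIn.of_closed (U := B A) hw (Set.mem_insert _ _)
            fun u hu w hw => hcl A G hglue u w hw.1 hw.2.2 hu).2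
      refine Subtype.ext (Finset.coe_injective ?_)
      rw [hA₀, Set.Finite.coe_toFinset, ← hAB', hBdef]
      simp only
      rw [Set.insert_sdiff_self_of_notMem (by simpa using A.2.2)]
  · rintro A G ⟨hglue, hA⟩
    have h1 := (hPtrue A G).mp (hA true)
    have h2 := contains_connectedSubclass_iff.mp (hA false)
    refine contains_connectedSubclass_iff.mpr ⟨(hiff A G hglue).mpr fun i => ?_, ?_⟩
    · cases i
      · exact h2.1
      · exact h1.1
    · rw [connected_iff_connIn_univ]
      have key : ∀ w, G.ConnIn Set.univ r w := by
        intro w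
        by_cases hw : w ∈ B A
        · exact ((induce_connected_iff.mp h1.2.1).2 r (Set.mem_insert _ _) w (Or.inr hw)).mono
            (Set.subset_univ _)
        · exact ((induce_connected_iff.mp h2.2).2 r (hrB A) w hw).mono (Set.subset_univ _)
      exact ⟨⟨r⟩, fun u w => (key u).symm.trans (key w)⟩

/-- Decomposition of a graph at a root that is not a cut vertex into the block at the root and the
connected graphs hanging from the other vertices of the block. -/
theorem BlockStable.card_nonCutRooted_eq_sum [Fintype V] [DecidableEq V] (h : 𝒢.BlockStable)
    (r : V) :
    Nat.card {G : SimpleGraph V // 𝒢.NonCutRooted r G} =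
      ∑ f : {f : V → V // (∀ v, f (f v) = f v) ∧ ∀ v, f v = r ↔ v = r},
        𝒢.twoConnectedSubclass.count {v | f.1 v = v}.ncard *
          ∏ s : {s // f.1 s = s ∧ s ≠ r}, 𝒢.connectedSubclass.count {v | f.1 v = s}.ncard := by
  -- The piece `none` is the block at `r`, and `some s` is the connected graph hanging from `s`. The
  -- fibre over `r` is just `r` and gives no piece.
  set pc : ∀ f : {f : V → V // (∀ v, f (f v) = f v) ∧ ∀ v, f v = r ↔ v = r},
      Option {s // f.1 s = s ∧ s ≠ r} → Set V := fun f i =>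
    match i with
    | none => {v | f.1 v = v}
    | some s => {v | f.1 v = s} with hpc
  set cl : ∀ f : {f : V → V // (∀ v, f (f v) = f v) ∧ ∀ v, f v = r ↔ v = r},
      Option {s // f.1 s = s ∧ s ≠ r} → LabelledGraphClass := fun f i =>
    match i with
    | none => 𝒢.twoConnectedSubclass
    | some _ => 𝒢.connectedSubclass with hclass
  have hdis : ∀ f i j, i ≠ j → (pc f i ∩ pc f j).Subsingleton := by
    rintro f (_ | s) (_ | s') hij x ⟨hx1, hx2⟩ y ⟨hy1, hy2⟩
    · exact absurd rfl hij
    · exact (hx1.symm.trans hx2).trans (hy1.symm.trans hy2).symm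
    · exact (hx2.symm.trans hx1).trans (hy2.symm.trans hy1).symm
    · exact absurd (congrArg some (Subtype.ext (hx1.symm.trans hx2))) hij
  have hretr : ∀ f (G : SimpleGraph V), G.GluedAlong (pc f) ∧
      (G.induce {v | f.1 v = v}).IsTwoConnected ∧ (∀ s : {s // f.1 s = s ∧ s ≠ r},
        (G.induce {v | f.1 v = s}).Connected) ↔ G.IsBlockRetraction r f.1 := by
    intro f G
    constructor
    · rintro ⟨h1, h2, h3⟩
      refine ⟨f.2.1, f.2.2, fun u v huv => ?_, h2, fun s hs hsr => h3 ⟨s, hs, hsr⟩⟩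
      obtain ⟨_ | s, hu, hv⟩ := h1 u v huv
      · exact Or.inl ⟨hu, hv⟩
      · exact Or.inr (hu.trans hv.symm)
    · intro hf
      refine ⟨fun u v huv => ?_, hf.block, fun s => hf.fiber s s.2.1 s.2.2⟩
      rcases hf.adj u v huv with ⟨hu, hv⟩ | huv'
      · exact ⟨none, hu, hv⟩
      -- Both ends of an edge cannot be sent to `r`, the fibre of `r` being a single vertex.
      · by_cases hr : f.1 u = r
        · exact absurd (((f.2.2 u).mp hr).trans ((f.2.2 v).mp (huv' ▸ hr)).symm) huv.ne
        · exact ⟨some ⟨f.1 u, f.2.1 u, hr⟩, rfl, huv'.symm⟩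
  have hiff : ∀ f (G : SimpleGraph V), G.IsBlockRetraction r f.1 →
      (𝒢.Contains G ↔ ∀ i, 𝒢.Contains (G.induce (pc f i))) := by
    intro f G hf
    refine h.contains_iff_forall_induce (hdis f) fun T hT => ?_
    rcases hf.subset_of_isTwoConnected hT with h1 | ⟨s, hs, hsr, h1⟩
    · exact ⟨none, h1⟩
    · exact ⟨some ⟨s, hs, hsr⟩, h1⟩
  have hR : ∀ f (G : SimpleGraph V), (G.GluedAlong (pc f) ∧
      ∀ i, (cl f i).Contains (G.induce (pc f i))) ↔ 𝒢.Contains G ∧ G.IsBlockRetraction r f.1 := by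
    intro f G
    constructor
    · rintro ⟨h1, h2⟩
      have hb := contains_twoConnectedSubclass_iff.mp (h2 none)
      have hc := fun s => contains_connectedSubclass_iff.mp (h2 (some s))
      have hf := (hretr f G).mp ⟨h1, hb.2, fun s => (hc s).2⟩
      refine ⟨(hiff f G hf).mpr fun i => ?_, hf⟩
      rcases i with _ | s
      · exact hb.1
      · exact (hc s).1
    · rintro ⟨h1, hf⟩
      obtain ⟨h2, h3, h4⟩ := (hretr f G).mpr hf
      refine ⟨h2, fun i => ?_⟩
      have hi := (hiff f G hf).mp h1 i
      rcases i with _ | s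
      · exact contains_twoConnectedSubclass_iff.mpr ⟨hi, h3⟩
      · exact contains_connectedSubclass_iff.mpr ⟨hi, h4 s⟩
  rw [Nat.card_subtype_eq_sum (R := fun f G => G.GluedAlong (pc f) ∧
    ∀ i, (cl f i).Contains (G.induce (pc f i)))]
  · refine Finset.sum_congr rfl fun f _ => ?_
    rw [card_glued (hdis f) fun i H => (cl f i).Contains H, Fintype.prod_option, card_contains]
    simp_rw [card_contains]
    rfl
  · rintro G ⟨h1, h2, h3⟩
    obtain ⟨f, hf⟩ := exists_isBlockRetraction h2 h3
    refine ⟨⟨f, hf.idem, hf.eq_root_iff⟩, (hR _ G).mpr ⟨h1, hf⟩, fun f' hf' => ?_⟩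
    exact Subtype.ext (((hR f' G).mp hf').2.unique hf)
  · intro f G hG
    obtain ⟨h1, h2⟩ := (hR f G).mp hG
    exact ⟨h1, h2.connected, h2.induce_compl_connected⟩

end LabelledGraphClass

/-! ### Exponential generating functions -/

namespace PowerSeries

theorem derivative_finset_prod {I : Type*} [DecidableEq I] (s : Finset I) (F : I → ℝ⟦X⟧) :
    derivative ℝ (∏ i ∈ s, F i) =
      ∑ j ∈ s, ∏ i ∈ s, Function.update F j (derivative ℝ (F j)) i := by
  induction s using Finset.induction_on with
  | empty => simp
  | insert a s ha ih =>
    rw [Finset.prod_insert ha, Derivation.leibniz, ih, Finset.sum_insert ha, Finset.prod_insert ha,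
      Function.update_self, smul_eq_mul, smul_eq_mul, Finset.mul_sum, add_comm]
    congr 1
    · rw [mul_comm]
      congr 1
      refine Finset.prod_congr rfl fun i hi => ?_
      rw [Function.update_of_ne (by rintro rfl; exact ha hi)]
    · refine Finset.sum_congr rfl fun j hj => ?_
      rw [Finset.prod_insert ha, Function.update_of_ne (by rintro rfl; exact ha hj)]

/-- The exponential generating function of a sequence. -/
noncomputable def egfOf (a : ℕ → ℝ) : ℝ⟦X⟧ := mk fun n => a n / n.factorial

theorem coeff_egfOf (a : ℕ → ℝ) (n : ℕ) : coeff n (egfOf a) = a n / n.factorial := coeff_mk _ _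

theorem derivative_egfOf (a : ℕ → ℝ) : derivative ℝ (egfOf a) = egfOf fun n => a (n + 1) := by
  ext n
  rw [coeff_derivative, coeff_egfOf, coeff_egfOf, Nat.factorial_succ]
  push_cast
  field_simp

theorem nonneg_egfOf {a : ℕ → ℝ} (ha : ∀ n, 0 ≤ a n) : (egfOf a).Nonneg := fun n => by
  rw [coeff_egfOf]; exact div_nonneg (ha n) (by positivity)

theorem egfOf_eq_mul {a b c : ℕ → ℝ} (h : ∀ n, a n =
    ∑ k ∈ Finset.range (n + 1), (n.choose k : ℝ) * (b k * c (n - k))) :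
    egfOf a = egfOf b * egfOf c := by
  ext n
  rw [coeff_mul, coeff_egfOf, h, Finset.sum_div, Finset.Nat.sum_antidiagonal_eq_sum_range_succ_mk
    (fun p => coeff p.1 (egfOf b) * coeff p.2 (egfOf c))]
  refine Finset.sum_congr rfl fun k hk => ?_
  rw [coeff_egfOf, coeff_egfOf, Nat.cast_choose ℝ (Nat.lt_succ_iff.mp (Finset.mem_range.mp hk))]
  have : (n.factorial : ℝ) ≠ 0 := by positivity
  field_simp

/-- The product formula for exponential generating functions, with maps to `I` in place of ordered
set partitions. Fixing the image $j$ of the first element shifts the sequence `a j`, that is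
differentiates the $j$-th factor; summing over $j$ is the product rule. -/
theorem sum_prod_card_fiber_fin {I : Type*} [Fintype I] [DecidableEq I] (n : ℕ) (a : I → ℕ → ℝ) :
    ∑ g : Fin n → I, ∏ i, a i (Finset.univ.filter fun x => g x = i).card =
      n.factorial * coeff n (∏ i, egfOf (a i)) := by
  induction n generalizing a with
  | zero => simp [map_prod, ← coeff_zero_eq_constantCoeff_apply, coeff_egfOf]
  | succ n ih =>
    have hshift : ∀ (j : I) (g : Fin n → I),
        ∏ i, a i (Finset.univ.filter fun x => (Fin.cons j g : Fin (n + 1) → I) x = i).card =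
        ∏ i, Function.update a j (fun m => a j (m + 1)) i
          (Finset.univ.filter fun x => g x = i).card := by
      intro j g
      refine Finset.prod_congr rfl fun i _ => ?_
      rw [Fin.card_filter_univ_succ]
      by_cases hij : i = j
      · subst hij; simp
      · rw [Function.update_of_ne hij]
        simp [Ne.symm hij]
    have hder := derivative_finset_prod Finset.univ fun i => egfOf (a i)
    have hc := congrArg (coeff n) hder
    rw [coeff_derivative, map_sum] at hc
    rw [← (Fin.consEquiv fun _ : Fin (n + 1) => I).sum_comp, Fintype.sum_prod_type]
    have hstep : ∀ j, ∑ g : Fin n → I, ∏ i, a i (Finset.univ.filter fun x =>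
        (Fin.cons j g : Fin (n + 1) → I) x = i).card = n.factorial *
        coeff n (∏ i, Function.update (fun i => egfOf (a i)) j (derivative ℝ (egfOf (a j))) i) := by
      intro j
      simp_rw [hshift, ih]
      congr 2
      refine Finset.prod_congr rfl fun i _ => ?_
      by_cases hij : i = j
      · subst hij; simp [derivative_egfOf]
      · rw [Function.update_of_ne hij, Function.update_of_ne hij]
    calc _ = ∑ j, _ := Finset.sum_congr rfl fun j _ => hstep j
      _ = _ := by
        rw [← Finset.mul_sum, ← hc, Nat.factorial_succ]
        push_cast; ring

theorem sum_prod_card_fiber {X I : Type*} [Fintype X] [Fintype I] [DecidableEq I] [DecidableEq X]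
    (a : I → ℕ → ℝ) :
    ∑ g : X → I, ∏ i, a i (Finset.univ.filter fun x => g x = i).card =
      (Fintype.card X).factorial * coeff (Fintype.card X) (∏ i, egfOf (a i)) := by
  rw [← sum_prod_card_fiber_fin]
  refine (Fintype.sum_equiv ((Fintype.equivFin X).arrowCongr (Equiv.refl I)) _ _ fun g => ?_)
  refine Finset.prod_congr rfl fun i _ => ?_
  congr 1
  refine Finset.card_equiv (Fintype.equivFin X) fun x => ?_
  simp

end PowerSeries

theorem Finset.sum_subtype_card {V M : Type*} [AddCommMonoid M] {p : Finset V → Prop}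
    [Fintype {A // p A}] {s : Finset V} (hp : ∀ A, p A ↔ A ⊆ s) (F : ℕ → M) :
    ∑ A : {A // p A}, F A.1.card = ∑ k ∈ Finset.range (s.card + 1), s.card.choose k • F k := by
  rw [← Finset.sum_powerset_apply_card, Finset.sum_subtype s.powerset (p := p)
    (fun A => by rw [Finset.mem_powerset, hp]) fun A => F A.card]

/-! ### Parametrizing retractions by their fixed points. -/

section Retraction

variable {V : Type*} [DecidableEq V] {r : V} {S : Finset V}

/-- The extension of a map to `S` by the identity. -/
def extendById (g : {v // v ≠ r ∧ v ∉ S} → S) (v : V) : V :=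
  if h : v ≠ r ∧ v ∉ S then g ⟨v, h⟩ else v

theorem extendById_of_pos (g : {v // v ≠ r ∧ v ∉ S} → S) {v : V} (h : v ≠ r ∧ v ∉ S) :
    extendById g v = g ⟨v, h⟩ := dif_pos h

theorem extendById_of_neg (g : {v // v ≠ r ∧ v ∉ S} → S) {v : V} (h : ¬ (v ≠ r ∧ v ∉ S)) :
    extendById g v = v := dif_neg h

theorem extendById_of_mem (g : {v // v ≠ r ∧ v ∉ S} → S) {v : V} (h : v ∈ S) :
    extendById g v = v := extendById_of_neg g fun h' => h'.2 h

theorem extendById_root (g : {v // v ≠ r ∧ v ∉ S} → S) : extendById g r = r :=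
  extendById_of_neg g fun h' => h'.1 rfl

theorem extendById_eq_self_iff (hS : r ∉ S) (g : {v // v ≠ r ∧ v ∉ S} → S) (v : V) :
    extendById g v = v ∧ v ≠ r ↔ v ∈ S := by
  constructor
  · rintro ⟨h1, h2⟩
    by_contra h3
    rw [extendById_of_pos g ⟨h2, h3⟩] at h1
    exact h3 (h1 ▸ (g _).2)
  · intro h
    exact ⟨extendById_of_mem g h, fun e => hS (e ▸ h)⟩

theorem extendById_idem (g : {v // v ≠ r ∧ v ∉ S} → S) (v : V) :
    extendById g (extendById g v) = extendById g v := by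
  by_cases h : v ≠ r ∧ v ∉ S
  · exact extendById_of_mem g (by rw [extendById_of_pos g h]; exact (g _).2)
  · rw [extendById_of_neg g h, extendById_of_neg g h]

theorem extendById_eq_root_iff (hS : r ∉ S) (g : {v // v ≠ r ∧ v ∉ S} → S) (v : V) :
    extendById g v = r ↔ v = r := by
  by_cases h : v ≠ r ∧ v ∉ S
  · refine ⟨fun e => absurd ?_ hS, fun e => absurd e h.1⟩
    have h2 := (g ⟨v, h⟩).2
    rwa [← extendById_of_pos g h, e] at h2
  · rw [extendById_of_neg g h]

/-- Retractions of `V` with `r` alone in its fiber correspond to their sets of fixed points together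
with arbitrary maps of the other vertices to the fixed points. -/
theorem sum_retraction_eq {M : Type*} [Fintype V] [AddCommMonoid M] (r : V)
    (Φ : (V → V) → M) :
    ∑ f : {f : V → V // (∀ v, f (f v) = f v) ∧ ∀ v, f v = r ↔ v = r}, Φ f.1 =
      ∑ S : {S : Finset V // r ∉ S}, ∑ g : {v // v ≠ r ∧ v ∉ S.1} → S.1, Φ (extendById g) := by
  rw [← Fintype.sum_sigma']
  symm
  refine Fintype.sum_bijective
    (fun p : (Σ S : {S : Finset V // r ∉ S}, {v // v ≠ r ∧ v ∉ S.1} → S.1) =>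
      (⟨extendById p.2, extendById_idem p.2, extendById_eq_root_iff p.1.2 p.2⟩ :
      {f : V → V // (∀ v, f (f v) = f v) ∧ ∀ v, f v = r ↔ v = r})) ⟨?_, ?_⟩ _ _ fun p => rfl
  · rintro ⟨S, g⟩ ⟨S', g'⟩ heq
    have hfun : extendById g = extendById g' := congrArg Subtype.val heq
    obtain rfl : S = S' := by
      refine Subtype.ext (Finset.ext fun v => ?_)
      rw [← extendById_eq_self_iff S.2 g v, ← extendById_eq_self_iff S'.2 g' v, hfun]
    congr 1
    funext v
    have := congrFun hfun v.1
    rw [extendById_of_pos _ v.2, extendById_of_pos _ v.2] at this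
    exact Subtype.ext this
  · rintro ⟨f, hf1, hf2⟩
    set S : Finset V := Finset.univ.filter fun v => f v = v ∧ v ≠ r with hS
    have hSm : ∀ v, v ∈ S ↔ f v = v ∧ v ≠ r := fun v => by simp [hS]
    have hfS : ∀ v, v ≠ r → f v ∈ S := fun v hv =>
      (hSm _).mpr ⟨hf1 v, fun e => hv ((hf2 v).mp e)⟩
    refine ⟨⟨⟨S, fun h => ((hSm r).mp h).2 rfl⟩, fun v => ⟨f v.1, hfS v.1 v.2.1⟩⟩, Subtype.ext ?_⟩
    funext v
    by_cases h : v ≠ r ∧ v ∉ S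
    · exact extendById_of_pos _ h
    · refine (extendById_of_neg _ h).trans ?_
      by_cases hv : v = r
      · rw [hv]; exact ((hf2 r).mpr rfl).symm
      · have : v ∈ S := by
          by_contra hvS
          exact h ⟨hv, hvS⟩
        exact ((hSm v).mp this).1.symm

theorem ncard_extendById_fixed (hS : r ∉ S) (g : {v // v ≠ r ∧ v ∉ S} → S) :
    {v | extendById g v = v}.ncard = S.card + 1 := by
  have : {v | extendById g v = v} = insert r (S : Set V) := by
    ext v
    by_cases hv : v = r
    · subst hv; simp [extendById_root]
    · have := extendById_eq_self_iff hS g v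
      simp only [hv, ne_eq, not_false_eq_true, and_true] at this
      simp [this, hv]
  rw [this, Set.ncard_insert_of_notMem (by simpa using hS), Set.ncard_coe_finset]

theorem ncard_extendById_fiber [Fintype V] (g : {v // v ≠ r ∧ v ∉ S} → S) (s : S) :
    {v | extendById g v = s}.ncard = (Finset.univ.filter fun x => g x = s).card + 1 := by
  have : {v | extendById g v = s} =
      insert (s : V) (Subtype.val '' ((Finset.univ.filter fun x => g x = s :
        Finset {v // v ≠ r ∧ v ∉ S}) : Set {v // v ≠ r ∧ v ∉ S})) := by
    ext v
    by_cases h : v ≠ r ∧ v ∉ S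
    · constructor
      · intro hv
        refine Or.inr ⟨⟨v, h⟩, Finset.mem_coe.mpr (Finset.mem_filter.mpr ⟨Finset.mem_univ _, ?_⟩), rfl⟩
        exact Subtype.ext ((extendById_of_pos g h).symm.trans hv)
      · rintro (rfl | ⟨x, hx, rfl⟩)
        · exact absurd s.2 h.2
        · exact (extendById_of_pos g x.2).trans
            (congrArg Subtype.val (Finset.mem_filter.mp (Finset.mem_coe.mp hx)).2)
    · rw [Set.mem_insert_iff]
      simp only [Set.mem_ofPred_eq, extendById_of_neg g h]
      refine ⟨Or.inl, fun h2 => h2.resolve_right ?_⟩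
      rintro ⟨x, -, hx⟩
      exact h (hx ▸ x.2)
  rw [this, Set.ncard_insert_of_notMem, Set.ncard_image_of_injective _ Subtype.val_injective,
    Set.ncard_coe_finset]
  rintro ⟨x, -, hx⟩
  exact x.2.2 (hx ▸ s.2)

end Retraction

/-! ### Functional equations of the generating functions. -/

namespace LabelledGraphClass

open PowerSeries SimpleGraph

variable {𝒢 : LabelledGraphClass}

theorem egf_eq_egfOf (𝒢 : LabelledGraphClass) : 𝒢.egf = egfOf fun n => (𝒢.count n : ℝ) := rfl

theorem derivedEgf_eq_egfOf (𝒢 : LabelledGraphClass) :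
    𝒢.derivedEgf = egfOf fun n => (𝒢.count (n + 1) : ℝ) := by
  rw [derivedEgf, egf_eq_egfOf, derivative_egfOf]

theorem nonneg_egf (𝒢 : LabelledGraphClass) : 𝒢.egf.Nonneg :=
  nonneg_egfOf fun _ => Nat.cast_nonneg _

theorem nonneg_derivedEgf (𝒢 : LabelledGraphClass) : 𝒢.derivedEgf.Nonneg := by
  rw [derivedEgf_eq_egfOf]; exact nonneg_egfOf fun _ => Nat.cast_nonneg _

theorem nonneg_rootedEgf (𝒢 : LabelledGraphClass) : 𝒢.rootedEgf.Nonneg :=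
  nonneg_X.mul 𝒢.nonneg_derivedEgf

theorem constantCoeff_rootedEgf (𝒢 : LabelledGraphClass) : constantCoeff 𝒢.rootedEgf = 0 := by
  simp [rootedEgf]

theorem coeff_rootedEgf (𝒢 : LabelledGraphClass) (n : ℕ) :
    coeff n 𝒢.rootedEgf = n * coeff n 𝒢.egf := by
  rcases n with _ | n
  · simp [rootedEgf]
  · rw [rootedEgf, coeff_succ_X_mul, derivedEgf, coeff_derivative]
    push_cast; ring

/-- The relation `𝒢' = 𝒞' 𝒢`. -/
theorem BlockStable.derivative_egf (h : 𝒢.BlockStable) :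
    derivative ℝ 𝒢.egf = derivative ℝ 𝒢.connectedSubclass.egf * 𝒢.egf := by
  rw [egf_eq_egfOf, egf_eq_egfOf, derivative_egfOf, derivative_egfOf]
  refine egfOf_eq_mul fun n => ?_
  have h1 := h.card_contains_eq_sum (0 : Fin (n + 1))
  rw [card_contains, Nat.card_eq_fintype_card, Fintype.card_fin] at h1
  rw [h1, Finset.sum_subtype_card (s := Finset.univ.erase 0) (fun A => by
    simp [Finset.subset_erase]) fun k =>
    𝒢.connectedSubclass.count (k + 1) * 𝒢.count (n + 1 - (k + 1))]
  rw [Finset.card_erase_of_mem (Finset.mem_univ _), Finset.card_univ, Fintype.card_fin,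
    Nat.add_sub_cancel]
  push_cast
  refine Finset.sum_congr rfl fun k _ => ?_
  rw [nsmul_eq_mul]
  push_cast
  rfl

/-- Graphs with a root that is not a cut vertex are enumerated by `ℬ'(𝒞•)`. -/
theorem BlockStable.card_nonCutRooted (h : 𝒢.BlockStable) {V : Type} [Finite V] (r : V) :
    (Nat.card {G : SimpleGraph V // 𝒢.NonCutRooted r G} : ℝ) = (Nat.card V - 1).factorial *
      coeff (Nat.card V - 1) (𝒢.twoConnectedSubclass.derivedEgf.subst
        𝒢.connectedSubclass.rootedEgf) := by
  classical
  have := Fintype.ofFinite V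
  set n := Nat.card V - 1 with hn
  set b := fun k => (𝒢.twoConnectedSubclass.count k : ℝ) with hb
  set c := fun k => (𝒢.connectedSubclass.count k : ℝ) with hc
  have hcard : Fintype.card V = n + 1 := by
    have : 0 < Nat.card V := Nat.card_pos_iff.mpr ⟨⟨r⟩, inferInstance⟩
    rw [← Nat.card_eq_fintype_card]; omega
  -- `S` is the set of non-root vertices of the block. Each of them carries a connected graph on
  -- itself and its $m$ preimages under `g`, so it contributes a factor $\mathcal C'$.
  have hinner : ∀ S : {S : Finset V // r ∉ S}, ∑ g : {v // v ≠ r ∧ v ∉ S.1} → S.1,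
      b {v | extendById g v = v}.ncard *
        ∏ s : {s // extendById g s = s ∧ s ≠ r}, c {v | extendById g v = s}.ncard =
      b (S.1.card + 1) * ((n - S.1.card).factorial *
        coeff (n - S.1.card) (𝒢.connectedSubclass.derivedEgf ^ S.1.card)) := by
    intro S
    have hX : Fintype.card {v // v ≠ r ∧ v ∉ S.1} = n - S.1.card := by
      have h1 : Fintype.card {v // v ≠ r ∧ v ∉ S.1} = ((insert r S.1)ᶜ : Finset V).card :=
        Fintype.card_of_subtype _ fun v => by simp
      rw [h1, Finset.card_compl, Finset.card_insert_of_notMem S.2, hcard, Nat.add_sub_add_right]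
    have hg : ∀ g : {v // v ≠ r ∧ v ∉ S.1} → S.1, b {v | extendById g v = v}.ncard *
        ∏ s : {s // extendById g s = s ∧ s ≠ r}, c {v | extendById g v = s}.ncard =
        b (S.1.card + 1) * ∏ s : S.1, c ((Finset.univ.filter fun x => g x = s).card + 1) := by
      intro g
      rw [ncard_extendById_fixed S.2]
      congr 1
      refine Fintype.prod_equiv (Equiv.subtypeEquivRight (extendById_eq_self_iff S.2 g)) _ _
        fun s => ?_
      rw [← ncard_extendById_fiber]
      rfl
    simp_rw [hg]
    rw [← Finset.mul_sum, sum_prod_card_fiber fun _ m => c (m + 1), hX, Finset.prod_const,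
      Finset.card_univ, Fintype.card_coe, derivedEgf_eq_egfOf]
  rw [h.card_nonCutRooted_eq_sum r]
  push_cast
  rw [sum_retraction_eq r fun f => b {v | f v = v}.ncard *
    ∏ s : {s // f s = s ∧ s ≠ r}, c {v | f v = s}.ncard]
  simp_rw [hinner]
  rw [Finset.sum_subtype_card (s := Finset.univ.erase r) (fun A => by
    simp [Finset.subset_erase]) fun k => b (k + 1) * ((n - k).factorial *
        coeff (n - k) (𝒢.connectedSubclass.derivedEgf ^ k))]
  rw [Finset.card_erase_of_mem (Finset.mem_univ _), Finset.card_univ, hcard,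
    Nat.add_sub_cancel, coeff_subst_eq_sum _ (constantCoeff_rootedEgf _), Finset.mul_sum]
  refine Finset.sum_congr rfl fun k hk => ?_
  have hkn := Nat.lt_succ_iff.mp (Finset.mem_range.mp hk)
  -- The factor $z^k$ in $(\mathcal C^\bullet)^k$ accounts for the $k$ labels of the non-root block
  -- vertices, and $\binom nk$ for their choice.
  rw [rootedEgf, mul_pow, coeff_X_pow_mul', if_pos hkn, derivedEgf_eq_egfOf, derivedEgf_eq_egfOf,
    coeff_egfOf, nsmul_eq_mul, Nat.cast_choose ℝ hkn]
  field_simp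
  exact mul_comm _ _

/-- The relation `𝒞'' = (ℬ'(𝒞•))' 𝒞'`. -/
theorem BlockStable.derivative_derivedEgf (h : 𝒢.BlockStable) :
    derivative ℝ 𝒢.connectedSubclass.derivedEgf =
      derivative ℝ (𝒢.twoConnectedSubclass.derivedEgf.subst 𝒢.connectedSubclass.rootedEgf) *
        𝒢.connectedSubclass.derivedEgf := by
  -- The root is `none`, so `n` counts the other vertices; the preceding formula shows that the
  -- count depends only on that number.
  set d : ℕ → ℕ := fun n =>
    Nat.card {G : SimpleGraph (Option (Fin n)) // 𝒢.NonCutRooted none G} with hd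
  have hdc : ∀ n, (d n : ℝ) = n.factorial * coeff n
      (𝒢.twoConnectedSubclass.derivedEgf.subst 𝒢.connectedSubclass.rootedEgf) := fun n => by
    have := h.card_nonCutRooted (none : Option (Fin n))
    simpa using this
  have hD : 𝒢.twoConnectedSubclass.derivedEgf.subst 𝒢.connectedSubclass.rootedEgf =
      egfOf fun n => (d n : ℝ) := by
    ext n
    rw [coeff_egfOf, hdc]
    have : (n.factorial : ℝ) ≠ 0 := by positivity
    field_simp
  have hd' : ∀ (W : Type) [Finite W] (r : W),
      Nat.card {G : SimpleGraph W // 𝒢.NonCutRooted r G} = d (Nat.card W - 1) := by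
    intro W _ r
    have h1 := h.card_nonCutRooted r
    rw [← hdc] at h1
    exact_mod_cast h1
  rw [hD, derivedEgf_eq_egfOf, derivative_egfOf, derivative_egfOf]
  refine egfOf_eq_mul fun n => ?_
  have h1 := h.card_connected_eq_sum (r := (0 : Fin (n + 2))) (v := 1) (by simp) hd'
  rw [card_contains, Nat.card_eq_fintype_card, Fintype.card_fin] at h1
  rw [h1, Finset.sum_subtype_card (s := (Finset.univ.erase 0).erase 1) (fun A => by
    simp [Finset.subset_erase]) fun k =>
    d (k + 1) * 𝒢.connectedSubclass.count (n + 2 - (k + 1))]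
  rw [Finset.card_erase_of_mem (by simp), Finset.card_erase_of_mem (Finset.mem_univ _),
    Finset.card_univ, Fintype.card_fin]
  push_cast
  refine Finset.sum_congr rfl fun k hk => ?_
  have hkn := Nat.lt_succ_iff.mp (Finset.mem_range.mp hk)
  rw [nsmul_eq_mul, show n + 1 - k = n - k + 1 by omega]
  push_cast
  rfl

theorem not_isTwoConnected_of_subsingleton {V : Type*} [Subsingleton V] (G : SimpleGraph V) :
    ¬ G.IsTwoConnected := fun h => not_nontrivial V h.1

theorem BlockStable.mem_of_subsingleton (h : 𝒢.BlockStable) {n : ℕ} [Subsingleton (Fin n)]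
    (G : SimpleGraph (Fin n)) : G ∈ 𝒢.graphs n :=
  (h.2 n G).mpr fun _ hS => absurd hS.1 (not_isTwoConnected_of_subsingleton _)

theorem BlockStable.constantCoeff_egf (h : 𝒢.BlockStable) : constantCoeff 𝒢.egf = 1 := by
  have h0 : 𝒢.graphs 0 = {⊥} :=
    Set.eq_singleton_iff_unique_mem.mpr ⟨h.mem_of_subsingleton ⊥, fun _ _ => Subsingleton.elim _ _⟩
  rw [← coeff_zero_eq_constantCoeff_apply, egf_eq_egfOf, coeff_egfOf, count, h0]
  simp

theorem constantCoeff_connectedSubclass_egf (𝒢 : LabelledGraphClass) :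
    constantCoeff 𝒢.connectedSubclass.egf = 0 := by
  have h0 : 𝒢.connectedSubclass.graphs 0 = ∅ :=
    Set.eq_empty_of_forall_notMem fun G hG => hG.2.nonempty.elim fun x => x.elim0
  rw [← coeff_zero_eq_constantCoeff_apply, egf_eq_egfOf, coeff_egfOf, count, h0]
  simp

theorem BlockStable.constantCoeff_connectedSubclass_derivedEgf (h : 𝒢.BlockStable) :
    constantCoeff 𝒢.connectedSubclass.derivedEgf = 1 := by
  have h1 : 𝒢.connectedSubclass.graphs 1 = {⊤} :=
    Set.eq_singleton_iff_unique_mem.mpr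
      ⟨⟨h.mem_of_subsingleton ⊤, connected_top⟩, fun _ _ => Subsingleton.elim _ _⟩
  rw [← coeff_zero_eq_constantCoeff_apply, derivedEgf_eq_egfOf, coeff_egfOf, count, h1]
  simp

theorem constantCoeff_twoConnectedSubclass_derivedEgf (𝒢 : LabelledGraphClass) :
    constantCoeff 𝒢.twoConnectedSubclass.derivedEgf = 0 := by
  have h1 : 𝒢.twoConnectedSubclass.graphs 1 = ∅ :=
    Set.eq_empty_of_forall_notMem fun G hG => not_isTwoConnected_of_subsingleton G hG.2
  rw [← coeff_zero_eq_constantCoeff_apply, derivedEgf_eq_egfOf, coeff_egfOf, count, h1]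
  simp

theorem isTwoConnected_top_of_nontrivial {V : Type*} [Nontrivial V] :
    (⊤ : SimpleGraph V).IsTwoConnected := by
  refine ⟨inferInstance, connected_top, fun v => ?_⟩
  obtain ⟨w, hw⟩ := exists_ne v
  have : Nonempty ({v}ᶜ : Set V) := ⟨⟨w, hw⟩⟩
  have h : (⊤ : SimpleGraph V).induce {v}ᶜ = ⊤ := by
    ext a b; simp [Subtype.ext_iff]
  rw [h]; exact connected_top

theorem BlockStable.one_le_coeff_one_derivedEgf (h : 𝒢.BlockStable) :
    1 ≤ coeff 1 𝒢.twoConnectedSubclass.derivedEgf := by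
  have h1 : (⊤ : SimpleGraph (Fin 2)) ∈ 𝒢.twoConnectedSubclass.graphs 2 :=
    ⟨h.1, isTwoConnected_top_of_nontrivial⟩
  have h2 : 1 ≤ 𝒢.twoConnectedSubclass.count 2 :=
    (Set.ncard_pos (Set.toFinite _)).mpr ⟨_, h1⟩
  rw [derivedEgf_eq_egfOf, coeff_egfOf]
  simpa using h2

/-- The relation `𝒞• = z exp(ℬ'(𝒞•))`. -/
theorem BlockStable.rootedEgf_eq (h : 𝒢.BlockStable) :
    𝒢.connectedSubclass.rootedEgf = X * subst 𝒢.connectedSubclass.rootedEgf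
      (subst 𝒢.twoConnectedSubclass.derivedEgf (exp ℝ) : ℝ⟦X⟧) := by
  have hy := constantCoeff_rootedEgf 𝒢.connectedSubclass
  have hb := constantCoeff_twoConnectedSubclass_derivedEgf 𝒢
  rw [subst_comp_subst_apply (HasSubst.of_constantCoeff_zero' hb)
    (HasSubst.of_constantCoeff_zero' hy)]
  have hD : constantCoeff (𝒢.twoConnectedSubclass.derivedEgf.subst
      𝒢.connectedSubclass.rootedEgf : ℝ⟦X⟧) = 0 := by
    rw [← coeff_zero_eq_constantCoeff_apply, coeff_subst_eq_sum _ hy]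
    simp [hb]
  -- The differential equation for $\mathcal C'$ with $\mathcal C'(0)=1$ gives $\mathcal
  -- C'=\exp(\mathcal B'(\mathcal C^\bullet))$; multiplying by $z$ finishes.
  rw [← eq_exp_subst_of_derivative hD h.constantCoeff_connectedSubclass_derivedEgf
    h.derivative_derivedEgf]
  rfl

/-- The relation `𝒢 = exp(𝒞)`. -/
theorem BlockStable.egf_eq_exp (h : 𝒢.BlockStable) :
    𝒢.egf = subst 𝒢.connectedSubclass.egf (exp ℝ) :=
  eq_exp_subst_of_derivative (constantCoeff_connectedSubclass_egf 𝒢) h.constantCoeff_egf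
    h.derivative_egf

/-- The coefficients of $\mathcal C$ are at most those of $\mathcal C^\bullet$, so $\mathcal C(x)$
is finite, and with it $\mathcal G(x)=e^{\mathcal C(x)}$. -/
theorem BlockStable.summable_egf (h : 𝒢.BlockStable) {x : ℝ} (hx : 0 ≤ x)
    (hs : Summable fun n => coeff n 𝒢.connectedSubclass.rootedEgf * x ^ n) :
    Summable fun n => coeff n 𝒢.egf * x ^ n := by
  have hC := nonneg_egf 𝒢.connectedSubclass
  have hsC : Summable fun n => coeff n 𝒢.connectedSubclass.egf * x ^ n := by
    refine Summable.of_nonneg_of_le (fun n => mul_nonneg (hC n) (by positivity)) (fun n => ?_) hs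
    rw [coeff_rootedEgf]
    gcongr
    rcases n with _ | n
    · simp [constantCoeff_connectedSubclass_egf]
    · have := hC (n + 1)
      push_cast
      nlinarith [n.cast_nonneg (α := ℝ)]
  refine summable_of_seriesValue_ne_top 𝒢.nonneg_egf hx ?_
  rw [h.egf_eq_exp, seriesValue_subst nonneg_exp hC (constantCoeff_connectedSubclass_egf 𝒢),
    seriesValue_eq_ofReal_tsum hC hx hsC,
    seriesValue_exp (tsum_nonneg fun n => mul_nonneg (hC n) (by positivity))]
  exact ENNReal.ofReal_ne_top

end LabelledGraphClass

/-! ### Conclusion. -/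

theorem mainTheorem1 (𝒢 : LabelledGraphClass) (hblock : 𝒢.BlockStable) (hsub : 𝒢.Subcritical)
    (hpos : ∃ n₀ : ℕ, ∀ n : ℕ, n₀ ≤ n →
      0 < PowerSeries.coeff n 𝒢.connectedSubclass.rootedEgf) :
    ∃ c γ : ℝ, 0 < c ∧ Real.exp 1 ≤ γ ∧
      ENNReal.ofReal γ = (seriesRadius 𝒢.connectedSubclass.rootedEgf)⁻¹ ∧
      Asymptotics.IsEquivalent Filter.atTop
        (fun n : ℕ => PowerSeries.coeff n 𝒢.egf)
        (fun n : ℕ => c * (n : ℝ) ^ (-(5 / 2) : ℝ) * γ ^ n) := by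
  have hy := 𝒢.connectedSubclass.nonneg_rootedEgf
  have hg := 𝒢.nonneg_egf
  obtain ⟨c, γ, hc, hγ, hrad, hs, hlim⟩ := PowerSeries.exists_asymptotics_of_subcritical
    𝒢.twoConnectedSubclass.nonneg_derivedEgf
    𝒢.constantCoeff_twoConnectedSubclass_derivedEgf hblock.one_le_coeff_one_derivedEgf hy
    𝒢.connectedSubclass.constantCoeff_rootedEgf hblock.rootedEgf_eq hsub
  have hγ0 : 0 < γ := (Real.exp_pos 1).trans_le hγ
  have hgs := hblock.summable_egf (inv_nonneg.mpr hγ0.le) hs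
  have hg0 : ∀ n, 0 ≤ PowerSeries.coeff n 𝒢.egf * γ⁻¹ ^ n := fun n =>
    mul_nonneg (hg n) (by positivity)
  -- This is $\mathcal G(\rho)$, positive because the empty graph belongs to the class; it is the
  -- factor by which the constants for $\mathcal C^\bullet$ and $\mathcal G$ differ.
  have hsum : 0 < ∑' n, PowerSeries.coeff n 𝒢.egf * γ⁻¹ ^ n :=
    hgs.tsum_pos hg0 0 (by simp [hblock.constantCoeff_egf])
  refine ⟨c * ∑' n, PowerSeries.coeff n 𝒢.egf * γ⁻¹ ^ n, γ, mul_pos hc hsum, hγ, hrad,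
    isEquivalent_of_tendsto_sqrt_mul_sq hγ0 (mul_pos hc hsum) ?_⟩
  refine tendsto_of_exp_recurrence (fun n => mul_nonneg (hy n) (by positivity)) hg0 hs hgs
    (fun n => ?_) hlim
  -- The relation $z\mathcal G'=\mathcal C^\bullet\mathcal G$, read off coefficientwise as the
  -- recurrence to be transferred.
  have h1 : PowerSeries.coeff n 𝒢.rootedEgf =
      PowerSeries.coeff n (𝒢.connectedSubclass.rootedEgf * 𝒢.egf) := by
    rw [LabelledGraphClass.rootedEgf, LabelledGraphClass.derivedEgf, hblock.derivative_egf,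
      ← mul_assoc]
    rfl
  rw [𝒢.coeff_rootedEgf, PowerSeries.coeff_mul] at h1
  rw [← mul_assoc, h1, Finset.sum_mul]
  refine Finset.sum_congr rfl fun p hp => ?_
  rw [← Finset.HasAntidiagonal.mem_antidiagonal.mp hp, pow_add]
  ring
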